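/- Let $K$ be an infinite field, $S=K[x_1,\dots,x_n]$, and let $I\subseteq S$ be a monomial ideal with minimal system of monomial generators $G(I)$. For a monomial $u\neq 1$ let $m(u)$ be the largest index $i$ with $x_i\mid u$, and put $m(1)=0$. The ideal $I$ is called stable if $x_i(u/x_{m(u)})\in I$ for all monomials $1\neq u\in I$ and all $i<m(u)$; an ideal generated by squarefree monomials is called squarefree stable if $x_i(u/x_{m(u)})$ lies in it for all squarefree monomials $u\neq 1$ of the ideal and all $i<m(u)$ with $x_i\nmid u$. The ideal $I$ is called Borel-fixed if $g(I)=I$ for every invertible upper triangular matrix $g=(g_{ij})$ over $K$, acting on $S$ by the $K$-algebra automorphism $x_j\mapsto\sum_{i\le j}g_{ij}x_i$. For a monomial $u=x_{i_1}x_{i_2}\cdots x_{i_d}$ with $i_1\le i_2\le\cdots\le i_d$ put $u^\sigma=x_{i_1}x_{i_2+1}\cdots x_{i_d+(d-1)}$, and let $I^\sigma$ be the ideal generated by the $u^\sigma$, $u\in G(I)$, in a polynomial ring $K[x_1,\dots,x_N]$, where $N\ge 0$ is any integer with $m(u)+\deg(u)-1\le N$ for all $u\in G(I)$. If $I$ is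 stable and Borel-fixed, then $I^\sigma$ is squarefree stable with $G(I^\sigma)=\{u^\sigma : u\in G(I)\}$, and $\beta_{i,j}(I)=\beta_{i,j}(I^\sigma)$ for all $i$ and $j$. Here $\beta_{i,j}$ denotes the graded Betti numbers: for a graded ideal $J$ of a standard graded polynomial ring $R$ over $K$, $\beta_{i,j}(J)$ is the number of summands $R(-j)$ in the $i$-th module of a minimal graded free $R$-resolution of $J$. (Such resolutions of $I$ over $S$ and of $I^\sigma$ over $K[x_1,\dots,x_N]$ exist, and the numbers do not depend on their choice.) -/

import Mathlib

namespace SqfreeShift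

open MvPolynomial

noncomputable section

/-! Monomials of `K[x_1, …, x_n]` are given by their exponent vectors `u : Fin n →₀ ℕ`;
the element `i : Fin n` stands for the variable `x_{i+1}`. -/

/-- The monomial with exponent vector `u` lies in `I`. -/
def MonMem {K : Type*} [Field K] {n : ℕ} (I : Ideal (MvPolynomial (Fin n) K))
    (u : Fin n →₀ ℕ) : Prop :=
  monomial u (1 : K) ∈ I

/-- The ideal generated by the monomials with exponent vectors in `A`. -/
def monomialSpan (K : Type*) [Field K] {n : ℕ} (A : Set (Fin n →₀ ℕ)) :
    Ideal (MvPolynomial (Fin n) K) :=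
  Ideal.span ((fun u => monomial u (1 : K)) '' A)

/-- Monomial ideals: ideals generated by monomials. -/
def IsMonomialIdeal {K : Type*} [Field K] {n : ℕ} (I : Ideal (MvPolynomial (Fin n) K)) : Prop :=
  ∃ A : Set (Fin n →₀ ℕ), I = monomialSpan K A

/-- A squarefree monomial. -/
def SqfreeMon {n : ℕ} (u : Fin n →₀ ℕ) : Prop := ∀ i, u i ≤ 1

/-- Squarefree monomial ideals: ideals generated by squarefree monomials. -/
def IsSqfreeIdeal {K : Type*} [Field K] {n : ℕ} (I : Ideal (MvPolynomial (Fin n) K)) : Prop :=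
  ∃ A : Set (Fin n →₀ ℕ), (∀ u ∈ A, SqfreeMon u) ∧ I = monomialSpan K A

/-- `G(I)`: the monomials of `I` that are minimal with respect to divisibility. For a monomial
ideal this is its unique minimal system of monomial generators. -/
def minGens {K : Type*} [Field K] {n : ℕ} (I : Ideal (MvPolynomial (Fin n) K)) :
    Set (Fin n →₀ ℕ) :=
  {u | Minimal (MonMem I) u}

/-- `k` is the largest index of a variable dividing the monomial `u`. -/
def IsMaxVar {n : ℕ} (u : Fin n →₀ ℕ) (k : Fin n) : Prop :=
  IsGreatest {i | i ∈ u.support} k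

/-- `m(u)`, the largest index of a variable dividing `u`, with variables numbered from `1`
(and `m(1) = 0`). -/
def maxVar {n : ℕ} (u : Fin n →₀ ℕ) : ℕ := u.support.sup fun i => (i : ℕ) + 1

/-- The monomial `x_i (u / x_k)`, for `x_k` dividing `u`. -/
def exchange {n : ℕ} (u : Fin n →₀ ℕ) (k i : Fin n) : Fin n →₀ ℕ :=
  u - Finsupp.single k 1 + Finsupp.single i 1

/-- Stable monomial ideals. -/
def IsStable {K : Type*} [Field K] {n : ℕ} (I : Ideal (MvPolynomial (Fin n) K)) : Prop :=
  IsMonomialIdeal I ∧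
    ∀ u, MonMem I u → ∀ k, IsMaxVar u k → ∀ i < k, MonMem I (exchange u k i)

/-- Squarefree stable ideals. -/
def IsSqfreeStable {K : Type*} [Field K] {n : ℕ} (I : Ideal (MvPolynomial (Fin n) K)) : Prop :=
  IsSqfreeIdeal I ∧
    ∀ u, SqfreeMon u → MonMem I u → ∀ k, IsMaxVar u k → ∀ i < k, i ∉ u.support →
      MonMem I (exchange u k i)

/-- The linear change of variables `x_j ↦ ∑ i, g i j * x_i`. -/
def linearSubst {K : Type*} [Field K] {n : ℕ} (g : Matrix (Fin n) (Fin n) K) :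
    MvPolynomial (Fin n) K →ₐ[K] MvPolynomial (Fin n) K :=
  aeval fun j => ∑ i, C (g i j) * X i

/-- Borel-fixed ideals: invariant under all invertible upper triangular linear changes of
variables, that is, `x_j ↦ ∑ i ≤ j, g i j * x_i` with all `g j j ≠ 0`. -/
def IsBorelFixed {K : Type*} [Field K] {n : ℕ} (I : Ideal (MvPolynomial (Fin n) K)) : Prop :=
  ∀ g : Matrix (Fin n) (Fin n) K, g.BlockTriangular id → IsUnit g.det →
    I.map (linearSubst g) = I

/-- For `u = x_{i_1} x_{i_2} ⋯ x_{i_d}` with `i_1 ≤ i_2 ≤ ⋯ ≤ i_d`, the list of indices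
`i_1, i_2 + 1, …, i_d + (d - 1)`. -/
def sigmaIndices {n : ℕ} (u : Fin n →₀ ℕ) : List ℕ :=
  ((Finsupp.toMultiset u).sort (· ≤ ·)).mapIdx fun j i => (i : ℕ) + j

/-- The monomial `u^σ` in `N` variables. It is meant for `m(u) + deg u - 1 ≤ N`, when all of
`sigmaIndices u` are indices of variables. -/
def sigmaMon {n : ℕ} (N : ℕ) (u : Fin n →₀ ℕ) : Fin N →₀ ℕ :=
  Finsupp.equivFunOnFinite.symm fun k => (sigmaIndices u).count (k : ℕ)

/-- The ideal `I^σ` of the polynomial ring in `N` variables, generated by the `u^σ` with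
`u ∈ G(I)`. -/
def sigmaIdeal {K : Type*} [Field K] {n : ℕ} (N : ℕ) (I : Ideal (MvPolynomial (Fin n) K)) :
    Ideal (MvPolynomial (Fin N) K) :=
  monomialSpan K (sigmaMon N '' minGens I)

/-- `p` is homogeneous of degree `e`, where `e` is an integer (so `p = 0` if `e < 0`). -/
def IsHomogOfDegree {K : Type*} [Field K] {n : ℕ} (p : MvPolynomial (Fin n) K) (e : ℤ) : Prop :=
  ∀ c ∈ p.support, (c.degree : ℤ) = e

/-- A minimal graded free resolution
`⋯ → F_2 → F_1 → F_0 → I → 0` of an ideal `I` of `S = K[x_1, …, x_n]`. The module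
`F_i = ⊕ S(-deg i b)` has a finite basis `b : basis i`, the basis element `b` being of degree
`deg i b`; the maps `F_{i+1} → F_i` and `F_0 → I` are homogeneous of degree `0`, the sequence is
exact, and the image of `F_{i+1}` lies in `(x_1, …, x_n) F_i`. -/
structure MinGradedFreeResolution {K : Type*} [Field K] {n : ℕ}
    (I : Ideal (MvPolynomial (Fin n) K)) where
  basis : ℕ → Type
  [basisFintype : ∀ i, Fintype (basis i)]
  deg : ∀ i, basis i → ℤ
  /-- The images of the basis elements of `F_0` in `I`. -/
  gen : basis 0 → MvPolynomial (Fin n) K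
  /-- The matrix of `F_{i+1} → F_i`. -/
  d : ∀ i, Matrix (basis i) (basis (i + 1)) (MvPolynomial (Fin n) K)
  gen_homog : ∀ b, IsHomogOfDegree (gen b) (deg 0 b)
  d_homog : ∀ i b c, IsHomogOfDegree (d i b c) (deg (i + 1) c - deg i b)
  range_gen : LinearMap.range (Fintype.linearCombination (MvPolynomial (Fin n) K) gen) = I
  exact_zero : LinearMap.range (d 0).mulVecLin =
    LinearMap.ker (Fintype.linearCombination (MvPolynomial (Fin n) K) gen)
  exact_succ : ∀ i, LinearMap.range (d (i + 1)).mulVecLin = LinearMap.ker (d i).mulVecLin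
  minimal : ∀ i b c, d i b c ∈ Ideal.span (Set.range (X : Fin n → MvPolynomial (Fin n) K))

attribute [instance] MinGradedFreeResolution.basisFintype

/-- The graded Betti number read off a minimal graded free resolution: the number of
summands `S(-j)` of `F_i`. -/
def MinGradedFreeResolution.betti {K : Type*} [Field K] {n : ℕ}
    {I : Ideal (MvPolynomial (Fin n) K)} (F : MinGradedFreeResolution I) (i : ℕ) (j : ℤ) : ℕ :=
  (Finset.univ.filter fun b : F.basis i => F.deg i b = j).card

end

end SqfreeShift

/-!
Both `I` and `I^σ` have linear quotients. Order the generators by degree, then by the sum of the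
indices of their variables, which exchanges lower. Modulo the earlier generators, the annihilator
of a generator `u` is generated by the variables `x_i` with `i < m(u)`, for `I`, and by those among
them that do not divide `u`, for `I^σ`. Iterated mapping cones of Koszul complexes then give a
minimal resolution in which `u` contributes `(|T| choose i)` summands of degree `i + deg u` to the
`i`-th module, where `T` is the set of these variables. Since `u^σ` has largest index
`m(u) + deg u - 1` and `deg u - 1` further variables, `m(u) - 1` variables remain for `u^σ`, as many
as for `u`.

A Borel-fixed monomial ideal contains, with a monomial `u`, every monomial obtained by replacing the
variables of `u` by ones of smaller index, equal variables by equal ones: the automorphism `x_j ↦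
x_j + x_i` followed by the substitution `x_j ↦ 0`, which preserves monomial ideals, replaces `x_j`
by `x_i`. This is what makes the inverse of the shift compatible with divisibility: it turns an
element `k` of a set `W` of indices into the variable whose position is given by the number of gaps
of `W` below `k`, and enlarging `W` lowers these positions. Hence the sets `W` whose unshifted
monomial lies in `I` form an upper set, and they inherit the exchange property.
-/

namespace SqfreeShift

open MvPolynomial

noncomputable section

/-! ### Homogeneous polynomials and graded matrices -/

section Homogeneous

variable {K : Type*} [Field K] {n : ℕ} {p q : MvPolynomial (Fin n) K} {d e : ℤ}

/-- The homogeneous component of integer degree `e`, which is `0` for `e < 0`. -/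
def homogComp (e : ℤ) : MvPolynomial (Fin n) K →ₗ[K] MvPolynomial (Fin n) K :=
  if 0 ≤ e then homogeneousComponent e.toNat else 0

theorem coeff_homogComp (e : ℤ) (p : MvPolynomial (Fin n) K) (m : Fin n →₀ ℕ) :
    coeff m (homogComp e p) = if (m.degree : ℤ) = e then coeff m p else 0 := by
  unfold homogComp
  split_ifs with he hm hm
  · rw [coeff_homogeneousComponent, if_pos (by omega)]
  · rw [coeff_homogeneousComponent, if_neg (by omega)]
  · omega
  · simp

theorem isHomogOfDegree_iff :
    IsHomogOfDegree p e ↔ ∀ m : Fin n →₀ ℕ, (m.degree : ℤ) ≠ e → coeff m p = 0 :=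
  forall_congr' fun m => by rw [mem_support_iff, not_imp_comm]

theorem isHomogOfDegree_homogComp (e : ℤ) (p : MvPolynomial (Fin n) K) :
    IsHomogOfDegree (homogComp e p) e :=
  isHomogOfDegree_iff.2 fun m hm => by rw [coeff_homogComp, if_neg hm]

theorem IsHomogOfDegree.homogComp_eq (hp : IsHomogOfDegree p e) : homogComp e p = p := by
  ext m
  rw [coeff_homogComp]
  split_ifs with hm
  · rfl
  · exact (isHomogOfDegree_iff.1 hp m hm).symm

theorem IsHomogOfDegree.homogComp_mul (hp : IsHomogOfDegree p d) (e : ℤ)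
    (q : MvPolynomial (Fin n) K) : homogComp (d + e) (p * q) = p * homogComp e q := by
  classical
  ext m
  rw [coeff_homogComp, coeff_mul, coeff_mul, Finset.ite_sum_zero]
  refine Finset.sum_congr rfl fun x hx => ?_
  rw [Finset.HasAntidiagonal.mem_antidiagonal] at hx
  have hdeg : m.degree = x.1.degree + x.2.degree := by rw [← hx, map_add]
  rw [coeff_homogComp]
  by_cases hx₁ : (x.1.degree : ℤ) = d
  · have hiff : (m.degree : ℤ) = d + e ↔ (x.2.degree : ℤ) = e := by omega
    simp only [hiff, mul_ite, mul_zero]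
  · simp only [isHomogOfDegree_iff.1 hp _ hx₁, zero_mul, ite_self]

theorem IsHomogOfDegree.mul (hp : IsHomogOfDegree p d) (hq : IsHomogOfDegree q e) :
    IsHomogOfDegree (p * q) (d + e) := by
  rw [← hq.homogComp_eq, ← hp.homogComp_mul]
  exact isHomogOfDegree_homogComp _ _

theorem IsHomogOfDegree.neg (hp : IsHomogOfDegree p e) : IsHomogOfDegree (-p) e := by
  rwa [IsHomogOfDegree, support_neg]

theorem isHomogOfDegree_zero (e : ℤ) : IsHomogOfDegree (0 : MvPolynomial (Fin n) K) e := by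
  simp [IsHomogOfDegree]

theorem isHomogOfDegree_monomial (u : Fin n →₀ ℕ) (c : K) :
    IsHomogOfDegree (monomial u c) (u.degree : ℤ) := fun m hm => by
  rw [Finset.mem_singleton.1 (support_monomial_subset hm)]

theorem isHomogOfDegree_C (c : K) : IsHomogOfDegree (C c : MvPolynomial (Fin n) K) 0 :=
  isHomogOfDegree_monomial 0 c

theorem IsHomogOfDegree.sum {ι : Type*} {s : Finset ι} {f : ι → MvPolynomial (Fin n) K}
    (hf : ∀ i ∈ s, IsHomogOfDegree (f i) e) : IsHomogOfDegree (∑ i ∈ s, f i) e := by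
  rw [isHomogOfDegree_iff]
  intro m hm
  rw [coeff_sum]
  exact Finset.sum_eq_zero fun i hi => isHomogOfDegree_iff.1 (hf i hi) m hm

theorem IsHomogOfDegree.prod {ι : Type*} (s : Finset ι) {f : ι → MvPolynomial (Fin n) K}
    {e : ι → ℤ} (hf : ∀ i ∈ s, IsHomogOfDegree (f i) (e i)) :
    IsHomogOfDegree (∏ i ∈ s, f i) (∑ i ∈ s, e i) := by
  classical
  induction s using Finset.induction_on with
  | empty => simpa using isHomogOfDegree_C (1 : K)
  | insert i s hi ih =>
    rw [Finset.prod_insert hi, Finset.sum_insert hi]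
    exact (hf i (Finset.mem_insert_self i s)).mul
      (ih fun k hk => hf k (Finset.mem_insert_of_mem hk))

theorem mem_span_X_iff :
    p ∈ Ideal.span (Set.range (X : Fin n → MvPolynomial (Fin n) K)) ↔ constantCoeff p = 0 := by
  rw [constantCoeff_eq, ← notMem_support_iff, ← Set.image_univ, mem_ideal_span_X_image]
  constructor
  · intro hp h0
    obtain ⟨i, -, hi⟩ := hp 0 h0
    exact hi rfl
  · intro h0 m hm
    obtain ⟨i, hi⟩ := Finsupp.ne_iff.1 (ne_of_mem_of_not_mem hm h0)
    exact ⟨i, Set.mem_univ i, hi⟩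

theorem IsHomogOfDegree.constantCoeff_eq_zero (hp : IsHomogOfDegree p e) (he : e ≠ 0) :
    constantCoeff p = 0 := by
  rw [constantCoeff_eq]
  exact isHomogOfDegree_iff.1 hp 0 (by simpa using he.symm)

theorem IsHomogOfDegree.eq_C_constantCoeff (hp : IsHomogOfDegree p 0) :
    p = C (constantCoeff p) := by
  classical
  ext m
  rw [coeff_C, constantCoeff_eq]
  split_ifs with hm
  · rw [hm]
  · exact isHomogOfDegree_iff.1 hp m
      (by rwa [Nat.cast_ne_zero, Ne, Finsupp.degree_eq_zero_iff, eq_comm])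

variable {a b c : Type*}

/-- The matrix `M` describes a homogeneous map of degree `0` between graded free modules with
bases `a` and `b` in degrees `da` and `db`. -/
def IsGradedMatrix (da : a → ℤ) (db : b → ℤ) (M : Matrix b a (MvPolynomial (Fin n) K)) : Prop :=
  ∀ y x, IsHomogOfDegree (M y x) (da x - db y)

theorem IsGradedMatrix.mul [Fintype b] {da : a → ℤ} {db : b → ℤ} {dc : c → ℤ}
    {M : Matrix c b (MvPolynomial (Fin n) K)} {M' : Matrix b a (MvPolynomial (Fin n) K)}
    (hM : IsGradedMatrix db dc M) (hM' : IsGradedMatrix da db M') :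
    IsGradedMatrix da dc (M * M') := fun z x =>
  IsHomogOfDegree.sum fun y _ => by
    rw [← sub_add_sub_cancel' (db y) (dc z) (da x)]
    exact (hM z y).mul (hM' y x)

theorem IsGradedMatrix.neg {da : a → ℤ} {db : b → ℤ}
    {M : Matrix b a (MvPolynomial (Fin n) K)} (hM : IsGradedMatrix da db M) :
    IsGradedMatrix da db (-M) := fun y x => (hM y x).neg

theorem isGradedMatrix_one [DecidableEq a] (da : a → ℤ) :
    IsGradedMatrix da da (1 : Matrix a a (MvPolynomial (Fin n) K)) := by
  intro y x
  rw [Matrix.one_apply]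
  split_ifs with h
  · rw [h, sub_self, ← C_1]
    exact isHomogOfDegree_C 1
  · exact isHomogOfDegree_zero _

theorem IsGradedMatrix.isHomogOfDegree_det [Fintype a] [DecidableEq a] {da : a → ℤ}
    {M : Matrix a a (MvPolynomial (Fin n) K)} (hM : IsGradedMatrix da da M) :
    IsHomogOfDegree M.det 0 := by
  rw [Matrix.det_apply']
  refine IsHomogOfDegree.sum fun σ _ => ?_
  have hprod := IsHomogOfDegree.prod Finset.univ fun i _ => hM (σ i) i
  rw [Finset.sum_sub_distrib, Equiv.sum_comp σ da, sub_self] at hprod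
  rw [← map_intCast (C : K →+* MvPolynomial (Fin n) K), ← add_zero (0 : ℤ)]
  exact (isHomogOfDegree_C _).mul hprod

theorem IsGradedMatrix.det_eq_one [Fintype a] [DecidableEq a] {da : a → ℤ}
    {M : Matrix a a (MvPolynomial (Fin n) K)} (hM : IsGradedMatrix da da M)
    (hM₁ : M.map constantCoeff = 1) : M.det = 1 := by
  rw [hM.isHomogOfDegree_det.eq_C_constantCoeff, RingHom.map_det, RingHom.mapMatrix_apply, hM₁,
    Matrix.det_one, C_1]

theorem range_mulVecLin_le_ker_iff {R : Type*} [CommRing R] [Fintype a] [Fintype b]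
    {D : Matrix c a R} {E : Matrix a b R} :
    LinearMap.range E.mulVecLin ≤ LinearMap.ker D.mulVecLin ↔ D * E = 0 := by
  classical
  rw [LinearMap.range_le_ker_iff, ← Matrix.mulVecLin_mul, ← Matrix.toLin'_apply',
    LinearEquiv.map_eq_zero_iff]

theorem exists_mul_eq_of_range_le {R : Type*} [CommRing R] [Fintype a] [Fintype c]
    {D : Matrix b a R} {E : Matrix b c R}
    (h : LinearMap.range E.mulVecLin ≤ LinearMap.range D.mulVecLin) :
    ∃ Y : Matrix a c R, D * Y = E := by
  have hcol : ∀ z, ∃ v : a → R, D.mulVec v = E.col z := fun z => by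
    have hz : E.col z ∈ LinearMap.range E.mulVecLin := by
      rw [Matrix.range_mulVecLin]
      exact Submodule.subset_span ⟨z, rfl⟩
    exact h hz
  choose v hv using hcol
  exact ⟨Matrix.of fun x z => v z x, Matrix.ext fun y z => congrFun (hv z) y⟩

theorem exists_graded_mul_eq_of_range_le [Fintype a] [Fintype c]
    {da : a → ℤ} {db : b → ℤ} {dc : c → ℤ}
    {D : Matrix b a (MvPolynomial (Fin n) K)} {E : Matrix b c (MvPolynomial (Fin n) K)}
    (hD : IsGradedMatrix da db D) (hE : IsGradedMatrix dc db E)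
    (h : LinearMap.range E.mulVecLin ≤ LinearMap.range D.mulVecLin) :
    ∃ Y : Matrix a c (MvPolynomial (Fin n) K), IsGradedMatrix dc da Y ∧ D * Y = E := by
  obtain ⟨Y, hY⟩ := exists_mul_eq_of_range_le h
  refine ⟨Matrix.of fun x z => homogComp (dc z - da x) (Y x z),
    fun x z => isHomogOfDegree_homogComp _ _, Matrix.ext fun y z => ?_⟩
  rw [← (hE y z).homogComp_eq, ← hY, Matrix.mul_apply, Matrix.mul_apply, map_sum]
  refine Finset.sum_congr rfl fun x _ => ?_
  rw [Matrix.of_apply, ← (hD y x).homogComp_mul, sub_add_sub_cancel']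

theorem IsGradedMatrix.exists_graded_mul_eq_one [Fintype a] [DecidableEq a] {da : a → ℤ}
    {M : Matrix a a (MvPolynomial (Fin n) K)} (hM : IsGradedMatrix da da M)
    (hM₁ : M.map constantCoeff = 1) :
    ∃ V : Matrix a a (MvPolynomial (Fin n) K), IsGradedMatrix da da V ∧ V * M = 1 := by
  have hsurj : Function.Surjective M.mulVecLin :=
    Matrix.mulVec_surjective_iff_isUnit.2
      ((Matrix.isUnit_iff_isUnit_det M).2 (hM.det_eq_one hM₁ ▸ isUnit_one))
  obtain ⟨V, hV, hMV⟩ := exists_graded_mul_eq_of_range_le hM (isGradedMatrix_one da)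
    (by rw [LinearMap.range_eq_top.2 hsurj]; exact le_top)
  exact ⟨V, hV, mul_eq_one_comm.1 hMV⟩

/-- A one-sided inverse identity between matrices over `K` restricts to each degree, since the
entries of `A` joining different degrees vanish; the rank then compares the two sizes. -/
theorem card_degree_le_of_mul_eq_one [Fintype a] [Fintype b] [DecidableEq a]
    {da : a → ℤ} {db : b → ℤ} {A : Matrix b a K} {B : Matrix a b K} (h : B * A = 1)
    (hA : ∀ y x, da x ≠ db y → A y x = 0) (j : ℤ) :
    (Finset.univ.filter fun x => da x = j).card ≤ (Finset.univ.filter fun y => db y = j).card := by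
  let A' : Matrix {y // db y = j} {x // da x = j} K := A.submatrix Subtype.val Subtype.val
  let B' : Matrix {x // da x = j} {y // db y = j} K := B.submatrix Subtype.val Subtype.val
  have hB'A' : B' * A' = 1 := by
    ext x x'
    rw [← Matrix.submatrix_one (Subtype.val : {x // da x = j} → a) Subtype.val_injective, ← h,
      Matrix.submatrix_apply, Matrix.mul_apply, Matrix.mul_apply]
    refine (Finset.sum_subtype (Finset.univ.filter fun y => db y = j) (by simp)
      fun y => B x y * A y x').symm.trans
        (Finset.sum_subset (Finset.subset_univ _) fun y _ hy => ?_)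
    have hxy : da x' ≠ db y := fun hxy => hy (by simp [← hxy, x'.2])
    rw [hA y x' hxy, mul_zero]
  have hrank := (Matrix.rank_mul_le_left B' A').trans (Matrix.rank_le_card_width B')
  rwa [hB'A', Matrix.rank_one, Fintype.card_subtype, Fintype.card_subtype] at hrank

end Homogeneous

/-! ### Uniqueness of the Betti numbers -/

section GradedRetract

variable {K : Type*} [Field K] {n : ℕ} {b₀ b₁ b₂ c₀ c₁ c₂ : Type*} [Fintype b₀] [Fintype b₁]
  [Fintype b₂] [Fintype c₀] [Fintype c₁] [Fintype c₂] [DecidableEq b₀]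
  {β₀ : b₀ → ℤ} {β₁ : b₁ → ℤ} {γ₀ : c₀ → ℤ} {γ₁ : c₁ → ℤ}

/-- Homogeneous maps `incl` and `retr` exhibiting a graded free module with basis `b₀` as a direct
summand of one with basis `c₀`, and compatible with the images of `D` and `E`. This is what two
resolutions with differentials `D` and `E` have in common in one homological degree. -/
structure GradedRetract (β₀ : b₀ → ℤ) (γ₀ : c₀ → ℤ)
    (D : Matrix b₀ b₁ (MvPolynomial (Fin n) K)) (E : Matrix c₀ c₁ (MvPolynomial (Fin n) K)) where
  incl : Matrix c₀ b₀ (MvPolynomial (Fin n) K)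
  retr : Matrix b₀ c₀ (MvPolynomial (Fin n) K)
  isGradedMatrix_incl : IsGradedMatrix β₀ γ₀ incl
  isGradedMatrix_retr : IsGradedMatrix γ₀ β₀ retr
  retr_mul_incl : retr * incl = 1
  range_incl_mul_le :
    LinearMap.range (incl * D).mulVecLin ≤ LinearMap.range E.mulVecLin
  range_retr_mul_le :
    LinearMap.range (retr * E).mulVecLin ≤ LinearMap.range D.mulVecLin

theorem GradedRetract.card_le {D : Matrix b₀ b₁ (MvPolynomial (Fin n) K)}
    {E : Matrix c₀ c₁ (MvPolynomial (Fin n) K)} (r : GradedRetract β₀ γ₀ D E) (j : ℤ) :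
    (Finset.univ.filter fun x => β₀ x = j).card ≤ (Finset.univ.filter fun y => γ₀ y = j).card := by
  have h : r.retr.map constantCoeff * r.incl.map constantCoeff = 1 := by
    rw [← Matrix.map_mul, r.retr_mul_incl, Matrix.map_one _ (map_zero _) (map_one _)]
  exact card_degree_le_of_mul_eq_one h
    (fun y x hxy => (r.isGradedMatrix_incl y x).constantCoeff_eq_zero (sub_ne_zero.2 hxy)) j

/-- The lifts `φ` and `ψ` of the inclusion and the retraction satisfy `D (ψ φ - 1) = 0`, so `ψ φ`
is congruent to `1` modulo the image of `D'`. By minimality it reduces to `1` modulo the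
variables, hence it is invertible and `ψ` can be corrected to a retraction. -/
theorem GradedRetract.nonempty_lift [DecidableEq b₁] {D : Matrix b₀ b₁ (MvPolynomial (Fin n) K)}
    {E : Matrix c₀ c₁ (MvPolynomial (Fin n) K)} {D' : Matrix b₁ b₂ (MvPolynomial (Fin n) K)}
    {E' : Matrix c₁ c₂ (MvPolynomial (Fin n) K)} (r : GradedRetract β₀ γ₀ D E)
    (hD : IsGradedMatrix β₁ β₀ D) (hE : IsGradedMatrix γ₁ γ₀ E)
    (exact_D : LinearMap.range D'.mulVecLin = LinearMap.ker D.mulVecLin)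
    (exact_E : LinearMap.range E'.mulVecLin = LinearMap.ker E.mulVecLin)
    (minimal : D'.map constantCoeff = 0) : Nonempty (GradedRetract β₁ γ₁ D' E') := by
  have hDD' : D * D' = 0 := range_mulVecLin_le_ker_iff.1 exact_D.le
  have hEE' : E * E' = 0 := range_mulVecLin_le_ker_iff.1 exact_E.le
  obtain ⟨φ, hφ, hEφ⟩ := exists_graded_mul_eq_of_range_le hE
    (r.isGradedMatrix_incl.mul hD) r.range_incl_mul_le
  obtain ⟨ψ, hψ, hDψ⟩ := exists_graded_mul_eq_of_range_le hD
    (r.isGradedMatrix_retr.mul hE) r.range_retr_mul_le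
  have hD_sub : D * (ψ * φ - 1) = 0 := by
    rw [Matrix.mul_sub, ← Matrix.mul_assoc, hDψ, Matrix.mul_assoc, hEφ, ← Matrix.mul_assoc,
      r.retr_mul_incl, Matrix.one_mul, Matrix.mul_one, sub_self]
  obtain ⟨Y, hY⟩ := exists_mul_eq_of_range_le
    ((range_mulVecLin_le_ker_iff.2 hD_sub).trans exact_D.ge)
  have hmod : (ψ * φ).map constantCoeff = 1 := by
    rw [← sub_add_cancel (ψ * φ) 1, ← hY, Matrix.map_add _ (map_add _), Matrix.map_mul, minimal,
      Matrix.zero_mul, zero_add, Matrix.map_one _ (map_zero _) (map_one _)]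
  obtain ⟨V, hV, hVψφ⟩ := (hψ.mul hφ).exists_graded_mul_eq_one hmod
  have hDV : D * V = D := by
    have h : D * (ψ * φ) = D := by rw [← sub_eq_zero, ← hD_sub, Matrix.mul_sub, Matrix.mul_one]
    rw [← h, Matrix.mul_assoc, mul_eq_one_comm.1 hVψφ, Matrix.mul_one, h]
  refine ⟨⟨φ, V * ψ, hφ, hV.mul hψ, by rw [Matrix.mul_assoc, hVψφ], ?_, ?_⟩⟩
  · rw [exact_E, range_mulVecLin_le_ker_iff, ← Matrix.mul_assoc, hEφ, Matrix.mul_assoc, hDD',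
      Matrix.mul_zero]
  · rw [exact_D, range_mulVecLin_le_ker_iff, ← Matrix.mul_assoc, ← Matrix.mul_assoc, hDV, hDψ,
      Matrix.mul_assoc, hEE', Matrix.mul_zero]

end GradedRetract

section Augmented

variable {R : Type*} [CommRing R] {b : Type*} [Fintype b]

theorem replicateRow_mulVec_apply (g v : b → R) (x : Unit) :
    (Matrix.replicateRow Unit g).mulVec v x = Fintype.linearCombination R g v := by
  simp only [Matrix.mulVec, dotProduct, Matrix.replicateRow_apply,
    Fintype.linearCombination_apply, smul_eq_mul, mul_comm]

theorem ker_mulVecLin_replicateRow (g : b → R) :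
    LinearMap.ker (Matrix.replicateRow Unit g).mulVecLin =
      LinearMap.ker (Fintype.linearCombination R g) := by
  ext v
  rw [LinearMap.mem_ker, LinearMap.mem_ker, ← replicateRow_mulVec_apply g v (), funext_iff,
    Unique.forall_iff]
  rfl

theorem mem_range_mulVecLin_replicateRow {g : b → R} {w : Unit → R} :
    w ∈ LinearMap.range (Matrix.replicateRow Unit g).mulVecLin ↔
      w () ∈ LinearMap.range (Fintype.linearCombination R g) := by
  refine exists_congr fun v => ?_
  rw [← replicateRow_mulVec_apply g v (), funext_iff, Unique.forall_iff]
  rfl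

theorem of_const_mulVec_apply [Unique b] {c : Type*} (u : R) (v : b → R) (x : c) :
    (Matrix.of fun (_ : c) (_ : b) => u).mulVec v x = u * v default := by
  simp only [Matrix.mulVec, dotProduct, Matrix.of_apply, Fintype.sum_unique]

end Augmented

namespace MinGradedFreeResolution

variable {K : Type*} [Field K] {n : ℕ} {I : Ideal (MvPolynomial (Fin n) K)}
  (F : MinGradedFreeResolution I)

/-- The bases of the augmented resolution `⋯ → F_1 → F_0 → S` of `S / I`, whose term in
homological degree `i + 1` is `F_i`. -/
def augBasis : ℕ → Type
  | 0 => Unit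
  | i + 1 => F.basis i

instance (i : ℕ) : Fintype (F.augBasis i) :=
  match i with
  | 0 => inferInstanceAs (Fintype Unit)
  | i + 1 => F.basisFintype i

instance : Unique (F.augBasis 0) := inferInstanceAs (Unique Unit)

/-- The degrees of the basis elements of the augmented resolution. -/
def augDeg : ∀ i, F.augBasis i → ℤ
  | 0 => fun _ => 0
  | i + 1 => F.deg i

/-- The differentials of the augmented resolution. -/
def augD : ∀ i, Matrix (F.augBasis i) (F.augBasis (i + 1)) (MvPolynomial (Fin n) K)
  | 0 => Matrix.replicateRow Unit F.gen
  | i + 1 => F.d i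

/-- The graded Betti numbers of the augmented resolution, that is, those of `S / I`. -/
def augBetti (i : ℕ) (j : ℤ) : ℕ :=
  (Finset.univ.filter fun b : F.augBasis i => F.augDeg i b = j).card

theorem augBetti_zero (j : ℤ) : F.augBetti 0 j = if j = 0 then 1 else 0 := by
  change (Finset.univ.filter fun _ : Unit => (0 : ℤ) = j).card = _
  rw [Finset.card_filter, Fintype.sum_unique]
  simp only [eq_comm]

theorem augBetti_succ (i : ℕ) (j : ℤ) : F.augBetti (i + 1) j = F.betti i j := rfl

theorem isGradedMatrix_augD : ∀ i, IsGradedMatrix (F.augDeg (i + 1)) (F.augDeg i) (F.augD i)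
  | 0 => fun _ c => (sub_zero (F.deg 0 c)).symm ▸ F.gen_homog c
  | i + 1 => F.d_homog i

theorem range_augD_succ : ∀ i,
    LinearMap.range (F.augD (i + 1)).mulVecLin = LinearMap.ker (F.augD i).mulVecLin
  | 0 => F.exact_zero.trans (ker_mulVecLin_replicateRow F.gen).symm
  | i + 1 => F.exact_succ i

theorem augD_mul_augD (i : ℕ) : F.augD i * F.augD (i + 1) = 0 :=
  range_mulVecLin_le_ker_iff.1 (F.range_augD_succ i).le

theorem mem_range_augD_zero {w : F.augBasis 0 → MvPolynomial (Fin n) K} :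
    w ∈ LinearMap.range (F.augD 0).mulVecLin ↔ w default ∈ I := by
  have h : w ∈ LinearMap.range (F.augD 0).mulVecLin ↔
      w default ∈ LinearMap.range (Fintype.linearCombination (MvPolynomial (Fin n) K) F.gen) :=
    mem_range_mulVecLin_replicateRow
  exact h.trans (by rw [F.range_gen])

theorem augD_succ_map_constantCoeff (i : ℕ) : (F.augD (i + 1)).map constantCoeff = 0 :=
  Matrix.ext fun b c => mem_span_X_iff.1 (F.minimal i b c)

theorem range_one_mul_augD_zero_le (G : MinGradedFreeResolution I) :
    LinearMap.range ((Matrix.of fun _ _ => 1 :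
      Matrix (G.augBasis 0) (F.augBasis 0) (MvPolynomial (Fin n) K)) * F.augD 0).mulVecLin ≤
        LinearMap.range (G.augD 0).mulVecLin := by
  rintro _ ⟨v, rfl⟩
  rw [mem_range_augD_zero, Matrix.mulVecLin_mul, LinearMap.comp_apply, Matrix.mulVecLin_apply,
    of_const_mulVec_apply, one_mul]
  exact F.mem_range_augD_zero.1 ⟨v, rfl⟩

theorem nonempty_gradedRetract_zero [DecidableEq (F.augBasis 0)] (G : MinGradedFreeResolution I) :
    Nonempty (GradedRetract (F.augDeg 0) (G.augDeg 0) (F.augD 0) (G.augD 0)) :=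
  ⟨{ incl := Matrix.of fun _ _ => 1
     retr := Matrix.of fun _ _ => 1
     isGradedMatrix_incl := fun _ _ => isHomogOfDegree_C 1
     isGradedMatrix_retr := fun _ _ => isHomogOfDegree_C 1
     retr_mul_incl := by
       ext x y
       rw [Subsingleton.elim x y, Matrix.one_apply_eq, Matrix.mul_apply, Fintype.sum_unique]
       exact congrArg _ (one_mul 1)
     range_incl_mul_le := F.range_one_mul_augD_zero_le G
     range_retr_mul_le := G.range_one_mul_augD_zero_le F }⟩

open Classical in
theorem nonempty_gradedRetract (G : MinGradedFreeResolution I) (i : ℕ) :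
    Nonempty (GradedRetract (F.augDeg i) (G.augDeg i) (F.augD i) (G.augD i)) := by
  induction i with
  | zero => exact F.nonempty_gradedRetract_zero G
  | succ i ih =>
    obtain ⟨r⟩ := ih
    exact r.nonempty_lift (F.isGradedMatrix_augD i) (G.isGradedMatrix_augD i)
      (F.range_augD_succ i) (G.range_augD_succ i) (F.augD_succ_map_constantCoeff i)

theorem betti_le (G : MinGradedFreeResolution I) (i : ℕ) (j : ℤ) : F.betti i j ≤ G.betti i j := by
  classical
  obtain ⟨r⟩ := F.nonempty_gradedRetract G (i + 1)
  exact r.card_le j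

theorem betti_eq (G : MinGradedFreeResolution I) (i : ℕ) (j : ℤ) : F.betti i j = G.betti i j :=
  (F.betti_le G i j).antisymm (G.betti_le F i j)

end MinGradedFreeResolution

/-! ### Mapping cones -/

section BlockMatrices

variable {R : Type*} [CommRing R] {m m' a a' b b' : Type*} [Fintype a] [Fintype a'] [Fintype b]
  [Fintype b']

theorem range_fromBlocks_eq_ker_fromCols {A : Matrix m a R} {A' : Matrix a a' R}
    {T : Matrix m b R} {T' : Matrix a b' R} {B' : Matrix b b' R}
    (exact_A : LinearMap.range A'.mulVecLin = LinearMap.ker A.mulVecLin)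
    (hT : A * T' = -(T * B'))
    (hB : ∀ v w, A.mulVec v + T.mulVec w = 0 → w ∈ LinearMap.range B'.mulVecLin) :
    LinearMap.range (Matrix.fromBlocks A' T' 0 B').mulVecLin =
      LinearMap.ker (Matrix.fromCols A T).mulVecLin := by
  apply le_antisymm
  · rw [range_mulVecLin_le_ker_iff, Matrix.fromCols_mul_fromBlocks, hT,
      range_mulVecLin_le_ker_iff.1 exact_A.le, Matrix.mul_zero, add_zero, neg_add_cancel,
      Matrix.fromCols_zero]
  · intro x hx
    rw [LinearMap.mem_ker, Matrix.mulVecLin_apply, Matrix.fromCols_mulVec] at hx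
    obtain ⟨z, hz⟩ := hB _ _ hx
    rw [Matrix.mulVecLin_apply] at hz
    have hker : x ∘ Sum.inl - T'.mulVec z ∈ LinearMap.ker A.mulVecLin := by
      rw [LinearMap.mem_ker, Matrix.mulVecLin_apply, Matrix.mulVec_sub, Matrix.mulVec_mulVec, hT,
        Matrix.neg_mulVec, sub_neg_eq_add, ← Matrix.mulVec_mulVec, hz, hx]
    rw [← exact_A] at hker
    obtain ⟨y, hy⟩ := hker
    rw [Matrix.mulVecLin_apply] at hy
    refine ⟨Sum.elim y z, ?_⟩
    rw [Matrix.mulVecLin_apply, Matrix.fromBlocks_mulVec, Sum.elim_comp_inl, Sum.elim_comp_inr,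
      Matrix.zero_mulVec, zero_add, hy, hz, sub_add_cancel, Sum.elim_comp_inl_inr]

theorem range_fromBlocks_eq_ker_fromBlocks {A : Matrix m a R} {A' : Matrix a a' R}
    {T : Matrix m b R} {T' : Matrix a b' R} {B : Matrix m' b R} {B' : Matrix b b' R}
    (exact_A : LinearMap.range A'.mulVecLin = LinearMap.ker A.mulVecLin)
    (exact_B : LinearMap.range B'.mulVecLin = LinearMap.ker B.mulVecLin)
    (hT : A * T' = -(T * B')) :
    LinearMap.range (Matrix.fromBlocks A' T' 0 B').mulVecLin =
      LinearMap.ker (Matrix.fromBlocks A T 0 B).mulVecLin := by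
  rw [← Matrix.fromCols_fromRows_eq_fromBlocks A T 0 B]
  refine range_fromBlocks_eq_ker_fromCols ?_ ?_ fun v w hvw => ?_
  · ext v
    simp [exact_A, Matrix.fromRows_mulVec, funext_iff]
  · rw [Matrix.fromRows_mul, Matrix.fromRows_mul, range_mulVecLin_le_ker_iff.1 exact_B.le, hT,
      Matrix.zero_mul, Matrix.fromRows_neg, neg_zero]
  · rw [exact_B, LinearMap.mem_ker]
    ext y
    have := congrFun hvw (Sum.inr y)
    simpa [Matrix.fromRows_mulVec] using this

theorem range_linearCombination_sumElim_const [Nonempty b] (g : a → R) (u : R) :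
    LinearMap.range (Fintype.linearCombination R (Sum.elim g fun _ : b => u)) =
      LinearMap.range (Fintype.linearCombination R g) ⊔ Ideal.span {u} := by
  rw [Fintype.range_linearCombination, Set.Sum.elim_range, Submodule.span_union, Set.range_const,
    Fintype.range_linearCombination]

end BlockMatrices

section MappingCone

variable {K : Type*} [Field K] {n : ℕ} {I L : Ideal (MvPolynomial (Fin n) K)}

/-- A lift of the multiplication by `u`, of degree `e`, to the augmented resolutions of `S / L`
and `S / I`. It anticommutes with the differentials, so that the mapping cone needs no signs. -/
structure MulLift (F : MinGradedFreeResolution I) (H : MinGradedFreeResolution L)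
    (u : MvPolynomial (Fin n) K) (e : ℤ) where
  map : ∀ i, Matrix (F.augBasis i) (H.augBasis i) (MvPolynomial (Fin n) K)
  map_zero : map 0 = Matrix.of fun _ _ => u
  isGradedMatrix_map : ∀ i, IsGradedMatrix (fun c => H.augDeg i c + e) (F.augDeg i) (map i)
  augD_mul_map : ∀ i, F.augD i * map (i + 1) = -(map i * H.augD i)

variable {F : MinGradedFreeResolution I} {H : MinGradedFreeResolution L}
  {u : MvPolynomial (Fin n) K} {e : ℤ}

theorem exists_map_succ {i : ℕ}
    {T : Matrix (F.augBasis i) (H.augBasis i) (MvPolynomial (Fin n) K)}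
    (hT : IsGradedMatrix (fun c => H.augDeg i c + e) (F.augDeg i) T)
    (hTF : LinearMap.range (T * H.augD i).mulVecLin ≤ LinearMap.range (F.augD i).mulVecLin) :
    ∃ T' : Matrix (F.augBasis (i + 1)) (H.augBasis (i + 1)) (MvPolynomial (Fin n) K),
      IsGradedMatrix (fun c => H.augDeg (i + 1) c + e) (F.augDeg (i + 1)) T' ∧
      LinearMap.range (T' * H.augD (i + 1)).mulVecLin ≤
        LinearMap.range (F.augD (i + 1)).mulVecLin ∧
      F.augD i * T' = -(T * H.augD i) := by
  have hH : IsGradedMatrix (fun c => H.augDeg (i + 1) c + e) (fun c => H.augDeg i c + e)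
      (H.augD i) := fun y x => by
    rw [add_sub_add_right_eq_sub]
    exact H.isGradedMatrix_augD i y x
  obtain ⟨T', hT', hmul⟩ :=
    exists_graded_mul_eq_of_range_le (F.isGradedMatrix_augD i) (hT.mul hH) hTF
  have hneg : F.augD i * -T' = -(T * H.augD i) := by rw [Matrix.mul_neg, hmul]
  refine ⟨-T', hT'.neg, ?_, hneg⟩
  rw [F.range_augD_succ, range_mulVecLin_le_ker_iff, ← Matrix.mul_assoc, hneg, Matrix.neg_mul,
    Matrix.mul_assoc, H.augD_mul_augD, Matrix.mul_zero, neg_zero]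

theorem nonempty_mulLift (hu : IsHomogOfDegree u e) (huL : ∀ p ∈ L, p * u ∈ I) :
    Nonempty (MulLift F H u e) := by
  let T₀ : Matrix (F.augBasis 0) (H.augBasis 0) (MvPolynomial (Fin n) K) :=
    Matrix.of fun _ _ => u
  have hT₀ : IsGradedMatrix (fun c => H.augDeg 0 c + e) (F.augDeg 0) T₀ := fun _ _ => by
    change IsHomogOfDegree u (0 + e - 0)
    rwa [zero_add, sub_zero]
  have hT₀F : LinearMap.range (T₀ * H.augD 0).mulVecLin ≤
      LinearMap.range (F.augD 0).mulVecLin := by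
    rintro _ ⟨v, rfl⟩
    rw [F.mem_range_augD_zero, Matrix.mulVecLin_mul, LinearMap.comp_apply, Matrix.mulVecLin_apply,
      of_const_mulVec_apply, mul_comm]
    exact huL _ (H.mem_range_augD_zero.1 ⟨v, rfl⟩)
  let Lift (i : ℕ) := {T : Matrix (F.augBasis i) (H.augBasis i) (MvPolynomial (Fin n) K) //
    IsGradedMatrix (fun c => H.augDeg i c + e) (F.augDeg i) T ∧
    LinearMap.range (T * H.augD i).mulVecLin ≤ LinearMap.range (F.augD i).mulVecLin}
  choose next hnext using fun i (T : Lift i) => exists_map_succ T.2.1 T.2.2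
  let lift (i : ℕ) : Lift i :=
    Nat.rec ⟨T₀, hT₀, hT₀F⟩ (fun i T => ⟨next i T, (hnext i T).1, (hnext i T).2.1⟩) i
  exact ⟨⟨fun i => (lift i).1, rfl, fun i => (lift i).2.1, fun i => (hnext i (lift i)).2.2⟩⟩

theorem MinGradedFreeResolution.augD_map_constantCoeff (H : MinGradedFreeResolution L)
    (hL : L ≤ Ideal.span (Set.range X)) (i : ℕ) : (H.augD i).map constantCoeff = 0 := by
  cases i with
  | zero =>
    ext _ c
    have hc : H.gen c ∈ LinearMap.range
        (Fintype.linearCombination (MvPolynomial (Fin n) K) H.gen) := by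
      rw [Fintype.range_linearCombination]
      exact Submodule.subset_span ⟨c, rfl⟩
    rw [H.range_gen] at hc
    exact mem_span_X_iff.1 (hL hc)
  | succ i => exact H.augD_succ_map_constantCoeff i

theorem MulLift.fromCols_augD_zero_map_zero (θ : MulLift F H u e) :
    Matrix.fromCols (F.augD 0) (θ.map 0) =
      Matrix.replicateRow Unit (Sum.elim F.gen fun _ : H.augBasis 0 => u) := by
  rw [θ.map_zero]
  exact Matrix.ext fun _ c => c.casesOn (fun _ => rfl) fun _ => rfl

theorem MulLift.range_fromBlocks_augD_zero (θ : MulLift F H u e)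
    (hcolon : ∀ p, p * u ∈ I → p ∈ L) :
    LinearMap.range (Matrix.fromBlocks (F.augD 1) (θ.map 1) 0 (H.augD 0)).mulVecLin =
      LinearMap.ker (Fintype.linearCombination (MvPolynomial (Fin n) K)
        (Sum.elim F.gen fun _ : H.augBasis 0 => u)) := by
  rw [← ker_mulVecLin_replicateRow, ← θ.fromCols_augD_zero_map_zero]
  refine range_fromBlocks_eq_ker_fromCols (F.range_augD_succ 0) (θ.augD_mul_map 0)
    fun v w hvw => ?_
  have hw : w default * u = -(F.augD 0).mulVec v default := by
    have hu : (θ.map 0).mulVec w default = u * w default := by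
      rw [θ.map_zero, of_const_mulVec_apply]
    rw [mul_comm, ← hu]
    exact eq_neg_of_add_eq_zero_right (congrFun hvw default)
  have hI : (F.augD 0).mulVec v default ∈ I := F.mem_range_augD_zero.1 ⟨v, rfl⟩
  exact H.mem_range_augD_zero.2 (hcolon _ (hw ▸ neg_mem hI))

/-- The mapping cone of a lift of the multiplication by `u`, which resolves `S / (I + (u))`. -/
def MulLift.cone (θ : MulLift F H u e) (hu : IsHomogOfDegree u e)
    (hcolon : ∀ p, p * u ∈ I → p ∈ L) (hL : L ≤ Ideal.span (Set.range X))
    (hdeg : ∀ i b c, F.augDeg (i + 1) b ≠ H.augDeg (i + 1) c + e) :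
    MinGradedFreeResolution (I ⊔ Ideal.span {u}) where
  basis i := F.augBasis (i + 1) ⊕ H.augBasis i
  deg i := Sum.elim (F.augDeg (i + 1)) fun c => H.augDeg i c + e
  gen := Sum.elim F.gen fun _ => u
  d i := Matrix.fromBlocks (F.augD (i + 1)) (θ.map (i + 1)) 0 (H.augD i)
  gen_homog
    | Sum.inl b => F.gen_homog b
    | Sum.inr _ => by
      change IsHomogOfDegree u (0 + e)
      rwa [zero_add]
  d_homog i
    | Sum.inl b, Sum.inl c => F.isGradedMatrix_augD (i + 1) b c
    | Sum.inl b, Sum.inr c => θ.isGradedMatrix_map (i + 1) b c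
    | Sum.inr _, Sum.inl _ => isHomogOfDegree_zero _
    | Sum.inr b, Sum.inr c => by
      simpa using H.isGradedMatrix_augD i b c
  range_gen := (range_linearCombination_sumElim_const F.gen u).trans (by rw [F.range_gen])
  exact_zero := θ.range_fromBlocks_augD_zero hcolon
  exact_succ i := range_fromBlocks_eq_ker_fromBlocks (F.range_augD_succ (i + 1))
    (H.range_augD_succ i) (θ.augD_mul_map (i + 1))
  minimal i
    | Sum.inl b, Sum.inl c => F.minimal i b c
    | Sum.inl b, Sum.inr c => mem_span_X_iff.2
        ((θ.isGradedMatrix_map (i + 1) b c).constantCoeff_eq_zero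
          (sub_ne_zero.2 (hdeg i b c).symm))
    | Sum.inr _, Sum.inl _ => Ideal.zero_mem _
    | Sum.inr b, Sum.inr c => mem_span_X_iff.2
        (congrFun (congrFun (H.augD_map_constantCoeff hL i) b) c)

theorem exists_resolution_sup_span_singleton (F : MinGradedFreeResolution I)
    (H : MinGradedFreeResolution L) (hu : IsHomogOfDegree u e)
    (hcolon : ∀ p, p * u ∈ I ↔ p ∈ L) (hL : L ≤ Ideal.span (Set.range X))
    (hdeg : ∀ i b c, F.augDeg (i + 1) b ≠ H.augDeg (i + 1) c + e) :
    ∃ G : MinGradedFreeResolution (I ⊔ Ideal.span {u}),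
      ∀ i j, G.betti i j = F.betti i j + H.augBetti i (j - e) := by
  obtain ⟨θ⟩ := nonempty_mulLift (F := F) (H := H) hu fun p hp => (hcolon p).2 hp
  refine ⟨θ.cone hu (fun p hp => (hcolon p).1 hp) hL hdeg, fun i j => ?_⟩
  simp only [MinGradedFreeResolution.betti, MinGradedFreeResolution.augBetti,
    Finset.card_filter, eq_sub_iff_add_eq]
  exact Fintype.sum_sum_type _

end MappingCone

/-! ### Monomial ideals with linear quotients -/

section MonomialIdeals

variable {K : Type*} [Field K] {n : ℕ} {I : Ideal (MvPolynomial (Fin n) K)}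
  {A : Set (Fin n →₀ ℕ)} {u v : Fin n →₀ ℕ}

theorem mem_monomialSpan {p : MvPolynomial (Fin n) K} :
    p ∈ monomialSpan K A ↔ ∀ m ∈ p.support, ∃ a ∈ A, a ≤ m :=
  mem_ideal_span_monomial_image

theorem monMem_monomialSpan : MonMem (monomialSpan K A) u ↔ ∃ a ∈ A, a ≤ u := by
  classical
  rw [MonMem, mem_monomialSpan, support_monomial, if_neg one_ne_zero]
  simp only [Finset.mem_singleton, forall_eq]

theorem MonMem.mono (hu : MonMem I u) (huv : u ≤ v) : MonMem I v := by
  obtain ⟨w, rfl⟩ := exists_add_of_le huv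
  rw [MonMem, add_comm, ← mul_one (1 : K), ← monomial_mul]
  exact I.mul_mem_left _ hu

theorem MonMem.exists_minGens_le (hu : MonMem I u) : ∃ w ∈ minGens I, w ≤ u := by
  obtain ⟨w, hwu, hw⟩ := exists_minimal_le_of_wellFoundedLT (MonMem I) u hu
  exact ⟨w, hw, hwu⟩

theorem minGens_finite (I : Ideal (MvPolynomial (Fin n) K)) : (minGens I).Finite :=
  WellQuasiOrderedLE.finite_of_isAntichain (setOfPred_minimal_antichain _)

theorem IsMonomialIdeal.mem_iff (hI : IsMonomialIdeal I) {p : MvPolynomial (Fin n) K} :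
    p ∈ I ↔ ∀ m ∈ p.support, MonMem I m := by
  obtain ⟨A, rfl⟩ := hI
  rw [mem_monomialSpan]
  exact forall₂_congr fun m _ => monMem_monomialSpan.symm

theorem IsMonomialIdeal.eq_monomialSpan_minGens (hI : IsMonomialIdeal I) :
    I = monomialSpan K (minGens I) := by
  ext p
  rw [hI.mem_iff, mem_monomialSpan]
  exact forall₂_congr fun m _ =>
    ⟨MonMem.exists_minGens_le, fun ⟨_, ha, ham⟩ => ha.prop.mono ham⟩

theorem minGens_monomialSpan (hA : IsAntichain (· ≤ ·) A) : minGens (monomialSpan K A) = A := by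
  ext u
  constructor
  · intro hu
    obtain ⟨a, ha, hau⟩ := monMem_monomialSpan.1 hu.prop
    rwa [← hu.eq_of_le (monMem_monomialSpan.2 ⟨a, ha, le_rfl⟩) hau]
  · intro hu
    refine ⟨monMem_monomialSpan.2 ⟨u, hu, le_rfl⟩, fun v hv hvu => ?_⟩
    obtain ⟨a, ha, hav⟩ := monMem_monomialSpan.1 hv
    rwa [← hA.eq ha hu (hav.trans hvu)]

theorem monomialSpan_insert (a : Fin n →₀ ℕ) (A : Set (Fin n →₀ ℕ)) :
    monomialSpan K (insert a A) = monomialSpan K A ⊔ Ideal.span {monomial a 1} := by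
  rw [monomialSpan, monomialSpan, Set.image_insert_eq, Ideal.span_insert, sup_comm]

theorem monomialSpan_empty : monomialSpan K (∅ : Set (Fin n →₀ ℕ)) = ⊥ := by
  rw [monomialSpan, Set.image_empty, Ideal.span_empty]

theorem span_X_image_eq_monomialSpan (T : Set (Fin n)) :
    Ideal.span (X '' T) = monomialSpan K ((fun i => Finsupp.single i 1) '' T) := by
  rw [monomialSpan, Set.image_image]
  rfl

theorem mul_monomial_mem_monomialSpan_iff {T : Set (Fin n)} {a : Fin n →₀ ℕ}
    (hlt : ∀ u ∈ A, ∃ i ∈ T, a i < u i) (hle : ∀ i ∈ T, ∃ w ∈ A, w ≤ a + Finsupp.single i 1)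
    (p : MvPolynomial (Fin n) K) :
    p * monomial a 1 ∈ monomialSpan K A ↔ p ∈ Ideal.span (X '' T) := by
  rw [mem_monomialSpan, mem_ideal_span_X_image]
  constructor
  · intro h m hm
    obtain ⟨u, hu, hum⟩ := h (m + a) (by rwa [mem_support_iff, coeff_mul_monomial, mul_one,
      ← mem_support_iff])
    obtain ⟨i, hi, hai⟩ := hlt u hu
    have hi' : u i ≤ m i + a i := hum i
    exact ⟨i, hi, by omega⟩
  · intro h m hm
    rw [mem_support_iff, coeff_mul_monomial', ite_ne_right_iff, mul_one, ← mem_support_iff] at hm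
    obtain ⟨ham, hm⟩ := hm
    obtain ⟨i, hi, hmi⟩ := h _ hm
    obtain ⟨w, hw, hwa⟩ := hle i hi
    refine ⟨w, hw, hwa.trans ?_⟩
    rw [← add_tsub_cancel_of_le ham]
    gcongr
    rwa [Finsupp.single_le_iff, Nat.one_le_iff_ne_zero]

theorem mul_X_mem_span_X_image_iff {T : Set (Fin n)} {a : Fin n} (ha : a ∉ T)
    (p : MvPolynomial (Fin n) K) : p * X a ∈ Ideal.span (X '' T) ↔ p ∈ Ideal.span (X '' T) := by
  nth_rw 1 [span_X_image_eq_monomialSpan]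
  refine mul_monomial_mem_monomialSpan_iff (a := Finsupp.single a 1) ?_ ?_ p
  · rintro _ ⟨i, hi, rfl⟩
    have hia : i ≠ a := ne_of_mem_of_not_mem hi ha
    exact ⟨i, hi, by simp [hia]⟩
  · exact fun i hi => ⟨_, Set.mem_image_of_mem _ hi, le_add_self⟩

end MonomialIdeals

section LinearQuotients

variable {n : ℕ}

theorem MinGradedFreeResolution.augBetti_augDeg_ne_zero {K : Type*} [Field K]
    {I : Ideal (MvPolynomial (Fin n) K)} (F : MinGradedFreeResolution I) (i : ℕ)
    (b : F.augBasis i) : F.augBetti i (F.augDeg i b) ≠ 0 :=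
  Finset.card_ne_zero.2 ⟨b, by rw [Finset.mem_filter_univ]⟩

theorem exists_resolution_bot (K : Type*) [Field K] (n : ℕ) :
    ∃ F : MinGradedFreeResolution (⊥ : Ideal (MvPolynomial (Fin n) K)),
      ∀ i j, F.betti i j = 0 :=
  ⟨{ basis := fun _ => Empty
     deg := fun _ => Empty.elim
     gen := Empty.elim
     d := fun _ => 0
     gen_homog := fun b => b.elim
     d_homog := fun _ b => b.elim
     range_gen := LinearMap.range_eq_bot.2 (Subsingleton.elim _ _)
     exact_zero := Subsingleton.elim _ _
     exact_succ := fun _ => Subsingleton.elim _ _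
     minimal := fun _ b => b.elim }, fun _ _ => rfl⟩

theorem exists_resolution_span_X (K : Type*) [Field K] (T : Finset (Fin n)) :
    ∃ F : MinGradedFreeResolution (Ideal.span (X '' (T : Set (Fin n))) :
      Ideal (MvPolynomial (Fin n) K)),
      ∀ (i : ℕ) (j : ℤ), F.augBetti i j = if j = i then T.card.choose i else 0 := by
  induction T using Finset.induction_on with
  | empty =>
    rw [Finset.coe_empty, Set.image_empty, Ideal.span_empty]
    obtain ⟨F, hF⟩ := exists_resolution_bot K n
    refine ⟨F, fun i j => ?_⟩
    cases i with
    | zero => simp [F.augBetti_zero]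
    | succ i => simp [F.augBetti_succ, hF]
  | insert a T ha ih =>
    obtain ⟨F, hF⟩ := ih
    have hdeg (i) (b : F.augBasis i) : F.augDeg i b = i := by
      by_contra h
      exact F.augBetti_augDeg_ne_zero i b (by rw [hF, if_neg h])
    have hX : IsHomogOfDegree (X a : MvPolynomial (Fin n) K) 1 := by
      have h := isHomogOfDegree_monomial (Finsupp.single a 1) (1 : K)
      rwa [Finsupp.degree_single] at h
    obtain ⟨G, hG⟩ := exists_resolution_sup_span_singleton F F hX
      (mul_X_mem_span_X_image_iff (Finset.mem_coe.not.2 ha))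
      (Ideal.span_mono (Set.image_subset_range _ _)) fun i b c => by
        rw [hdeg, hdeg]
        omega
    rw [Finset.coe_insert, Set.image_insert_eq, Ideal.span_insert, sup_comm]
    refine ⟨G, fun i j => ?_⟩
    cases i with
    | zero => simp [G.augBetti_zero]
    | succ i =>
      rw [G.augBetti_succ, hG, ← F.augBetti_succ, hF, hF, Finset.card_insert_of_notMem ha,
        Nat.choose_succ_succ', Nat.cast_succ]
      simp only [sub_eq_iff_eq_add]
      split_ifs <;> omega

/-- The monomials in `s` can be ordered with weakly increasing degrees such that, for each of them,
`a` say, the colon ideal of the ideal generated by its predecessors and of `a` is generated by the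
variables with indices in `T a`. This is stated combinatorially, independently of the field. -/
inductive HasLinearQuotients (T : (Fin n →₀ ℕ) → Finset (Fin n)) :
    Finset (Fin n →₀ ℕ) → Prop
  | empty : HasLinearQuotients T ∅
  | insert {s : Finset (Fin n →₀ ℕ)} {a : Fin n →₀ ℕ} (hs : HasLinearQuotients T s)
      (degree_le : ∀ u ∈ s, u.degree ≤ a.degree)
      (exists_lt : ∀ u ∈ s, ∃ i ∈ T a, a i < u i)
      (exists_le : ∀ i ∈ T a, ∃ w ∈ s, w ≤ a + Finsupp.single i 1) :
      HasLinearQuotients T (insert a s)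

theorem HasLinearQuotients.exists_resolution (K : Type*) [Field K]
    {T : (Fin n →₀ ℕ) → Finset (Fin n)} {s : Finset (Fin n →₀ ℕ)} (h : HasLinearQuotients T s) :
    ∃ F : MinGradedFreeResolution (monomialSpan K (s : Set (Fin n →₀ ℕ))),
      ∀ (i : ℕ) (j : ℤ), F.betti i j =
        ∑ u ∈ s, if j = i + u.degree then (T u).card.choose i else 0 := by
  induction h with
  | empty =>
    rw [Finset.coe_empty, monomialSpan_empty]
    exact exists_resolution_bot K n
  | @insert s a _ degree_le exists_lt exists_le ih =>
    obtain ⟨F, hF⟩ := ih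
    obtain ⟨H, hH⟩ := exists_resolution_span_X K (T a)
    have ha : a ∉ s := fun ha => by
      obtain ⟨i, -, hi⟩ := exists_lt a ha
      exact hi.false
    have hFdeg (i) (b : F.augBasis (i + 1)) : F.augDeg (i + 1) b ≤ i + a.degree := by
      have hb := F.augBetti_augDeg_ne_zero (i + 1) b
      rw [F.augBetti_succ, hF] at hb
      obtain ⟨u, hu, hub⟩ := Finset.exists_ne_zero_of_sum_ne_zero hb
      rw [(ite_ne_right_iff.1 hub).1]
      exact_mod_cast Nat.add_le_add_left (degree_le u hu) i
    have hHdeg (i) (c : H.augBasis i) : H.augDeg i c = i := by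
      by_contra hc
      exact H.augBetti_augDeg_ne_zero i c (by rw [hH, if_neg hc])
    obtain ⟨G, hG⟩ := exists_resolution_sup_span_singleton F H (isHomogOfDegree_monomial a 1)
      (mul_monomial_mem_monomialSpan_iff exists_lt exists_le)
      (Ideal.span_mono (Set.image_subset_range _ _)) fun i b c => by
        have := hFdeg i b
        rw [hHdeg]
        omega
    rw [Finset.coe_insert, monomialSpan_insert]
    refine ⟨G, fun i j => ?_⟩
    rw [hG, hF, hH, Finset.sum_insert ha, add_comm]
    simp only [sub_eq_iff_eq_add]

theorem hasLinearQuotients_of_key {T : (Fin n →₀ ℕ) → Finset (Fin n)} {β : Type*} [LinearOrder β]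
    (key : (Fin n →₀ ℕ) → β) {s : Finset (Fin n →₀ ℕ)}
    (hdeg : ∀ u ∈ s, ∀ v ∈ s, key u ≤ key v → u.degree ≤ v.degree)
    (hlt : ∀ u ∈ s, ∀ v ∈ s, u ≠ v → key u ≤ key v → ∃ i ∈ T v, v i < u i)
    (hle : ∀ v ∈ s, ∀ i ∈ T v, ∃ w ∈ s, key w < key v ∧ w ≤ v + Finsupp.single i 1) :
    HasLinearQuotients T s := by
  induction s using Finset.induction_on_max_value key with
  | empty => exact HasLinearQuotients.empty
  | insert a s ha hmax ih =>
    have hmem {u} (hu : u ∈ s) : u ∈ insert a s := Finset.mem_insert_of_mem hu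
    have ha' : a ∈ insert a s := Finset.mem_insert_self a s
    have mem_of_lt {v w} (hv : key v ≤ key a) (hw : w ∈ insert a s) (hwv : key w < key v) :
        w ∈ s :=
      Finset.mem_of_mem_insert_of_ne hw fun h => (h ▸ hwv.trans_le hv).false
    refine .insert (ih (fun u hu v hv => hdeg u (hmem hu) v (hmem hv))
      (fun u hu v hv => hlt u (hmem hu) v (hmem hv)) fun v hv i hi => ?_)
      (fun u hu => hdeg u (hmem hu) a ha' (hmax u hu))
      (fun u hu => hlt u (hmem hu) a ha' (ne_of_mem_of_not_mem hu ha) (hmax u hu)) fun i hi => ?_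
    · obtain ⟨w, hw, hwv, hle⟩ := hle v (hmem hv) i hi
      exact ⟨w, mem_of_lt (hmax v hv) hw hwv, hwv, hle⟩
    · obtain ⟨w, hw, hwa, hle⟩ := hle a ha' i hi
      exact ⟨w, mem_of_lt le_rfl hw hwa, hle⟩

end LinearQuotients

/-! ### Ideals stable under exchanges of monomials with bounded exponents -/

section BoundedStable

variable {n : ℕ} {u v : Fin n →₀ ℕ} {c : Fin n → ℕ∞} {i j k : Fin n}

theorem exchange_add_single (hk : k ∈ u.support) (i : Fin n) :
    exchange u k i + Finsupp.single k 1 = u + Finsupp.single i 1 := by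
  have hk' : Finsupp.single k 1 ≤ u := by
    rwa [Finsupp.single_le_iff, Nat.one_le_iff_ne_zero, ← Finsupp.mem_support_iff]
  rw [exchange, add_right_comm, tsub_add_cancel_of_le hk']

theorem exchange_apply_right (hik : i ≠ k) : exchange u k i i = u i + 1 := by
  simp [exchange, hik]

theorem exchange_apply_le (hji : j ≠ i) : exchange u k i j ≤ u j := by
  simp [exchange, hji]

theorem insert_erase_subset_support_exchange (hik : i ≠ k) :
    insert i (u.support.erase k) ⊆ (exchange u k i).support := by
  intro l hl
  rw [Finsupp.mem_support_iff]
  obtain rfl | hli := eq_or_ne l i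
  · exact (exchange_apply_right hik).trans_ne (Nat.succ_ne_zero _)
  · obtain ⟨hlk, hlu⟩ := Finset.mem_erase.1 (Finset.mem_of_mem_insert_of_ne hl hli)
    simpa [exchange, hli, hlk] using hlu

theorem degree_exchange (hk : k ∈ u.support) (i : Fin n) : (exchange u k i).degree = u.degree := by
  have h := congrArg Finsupp.degree (exchange_add_single hk i)
  simpa only [map_add, Finsupp.degree_single, Nat.add_right_cancel_iff] using h

theorem exists_isMaxVar (hu : u.support.Nonempty) : ∃ k, IsMaxVar u k :=
  ⟨_, u.support.isGreatest_max' hu⟩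

/-- The sum of the indices of the variables of `u`, counted with multiplicity. -/
def indexSum : (Fin n →₀ ℕ) →+ ℕ := Finsupp.weight fun i : Fin n => (i : ℕ)

theorem indexSum_exchange_lt (hk : k ∈ u.support) (hik : i < k) :
    indexSum (exchange u k i) < indexSum u := by
  have h := congrArg indexSum (exchange_add_single hk i)
  simp only [map_add, indexSum, Finsupp.weight_single, one_smul] at h
  simp only [indexSum]
  omega

/-- The generators of a stable ideal are added in the order of this key: first by degree, then by
the sum of the indices, which exchanges lower. -/
def generatorKey (u : Fin n →₀ ℕ) : ℕ ×ₗ ℕ := toLex (u.degree, indexSum u)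

theorem degree_le_of_generatorKey_le (h : generatorKey u ≤ generatorKey v) :
    u.degree ≤ v.degree := by
  rw [generatorKey, generatorKey, Prod.Lex.toLex_le_toLex'] at h
  exact h.1

theorem generatorKey_mono (h : u ≤ v) : generatorKey u ≤ generatorKey v := by
  obtain ⟨w, rfl⟩ := exists_add_of_le h
  refine Prod.Lex.toLex_mono ⟨?_, ?_⟩ <;> exact (map_add _ _ _).ge.trans' le_self_add

theorem generatorKey_exchange_lt (hk : k ∈ u.support) (hik : i < k) :
    generatorKey (exchange u k i) < generatorKey u :=
  Prod.Lex.toLex_lt_toLex.2 <| .inr ⟨degree_exchange hk i, indexSum_exchange_lt hk hik⟩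

/-- The exponent of each variable in `u` is at most its bound in `c`. -/
def ExponentsLE (c : Fin n → ℕ∞) (u : Fin n →₀ ℕ) : Prop := ∀ i, (u i : ℕ∞) ≤ c i

theorem ExponentsLE.exchange (hu : ExponentsLE c u) (hik : i ≠ k) (hi : (u i : ℕ∞) < c i) :
    ExponentsLE c (exchange u k i) := by
  intro j
  obtain rfl | hji := eq_or_ne j i
  · rw [exchange_apply_right hik, Nat.cast_succ]
    exact Order.add_one_le_of_lt hi
  · exact le_trans (mod_cast exchange_apply_le hji) (hu j)

open Classical in
/-- The variables with index less than `m(u)` whose exponent in `u` is still below the bound in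
`c`. -/
def exchangeVars (c : Fin n → ℕ∞) (u : Fin n →₀ ℕ) : Finset (Fin n) :=
  {i | (u i : ℕ∞) < c i ∧ ∃ k ∈ u.support, i < k}

theorem mem_exchangeVars :
    i ∈ exchangeVars c u ↔ (u i : ℕ∞) < c i ∧ ∃ k ∈ u.support, i < k :=
  Finset.mem_filter_univ i

theorem exchangeVars_zero (c : Fin n → ℕ∞) : exchangeVars c 0 = ∅ :=
  Finset.eq_empty_of_forall_notMem fun i hi => by simp [mem_exchangeVars] at hi

theorem card_exchangeVars_top (hk : IsMaxVar u k) : (exchangeVars ⊤ u).card = k := by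
  rw [← Fin.card_Iio]
  congr 1
  ext i
  rw [mem_exchangeVars, Finset.mem_Iio]
  exact ⟨fun ⟨_, l, hl, hil⟩ => hil.trans_le (hk.2 hl),
    fun h => ⟨ENat.natCast_lt_top _, k, hk.1, h⟩⟩

/-- Stability with respect to the monomials with exponents bounded by `c`: for `c = ⊤` this is the
exchange property of stable ideals, for `c = 1` that of squarefree stable ideals. -/
def IsBoundedStable {K : Type*} [Field K] (c : Fin n → ℕ∞) (I : Ideal (MvPolynomial (Fin n) K)) :
    Prop :=
  ∀ u, ExponentsLE c u → MonMem I u → ∀ k, IsMaxVar u k → ∀ i < k, (u i : ℕ∞) < c i →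
    MonMem I (exchange u k i)

theorem exponentsLE_one_iff : ExponentsLE 1 u ↔ SqfreeMon u :=
  forall_congr' fun _ => Nat.cast_le_one

theorem exists_exchange_le_sup (hdeg : u.degree ≤ v.degree)
    (hle : ∀ i, (∃ k ∈ v.support, i < k) → u i ≤ v i) (huv : ¬u ≤ v) :
    ∃ k, IsMaxVar u k ∧ ∃ i < k, u i < v i := by
  obtain ⟨l, hl⟩ : ∃ l, v l < u l := by
    by_contra! h
    exact huv h
  have hl_max {i} (hi : i ∈ v.support) : i ≤ l := by
    by_contra! h
    exact hl.not_ge (hle l ⟨i, hi, h⟩)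
  obtain ⟨i, hi⟩ : ∃ i, u i < v i := by
    by_contra! h
    obtain ⟨w, rfl⟩ := exists_add_of_le (show v ≤ u from h)
    rw [map_add, add_le_iff_nonpos_right, nonpos_iff_eq_zero, Finsupp.degree_eq_zero_iff] at hdeg
    exact huv (by rw [hdeg, add_zero])
  obtain ⟨k, hk⟩ := exists_isMaxVar (u := u) ⟨l, Finsupp.mem_support_iff.2 hl.ne_bot⟩
  have hil : i < l := (hl_max (Finsupp.mem_support_iff.2 hi.ne_bot)).lt_of_ne fun h =>
    (h ▸ hi).not_gt hl
  exact ⟨k, hk, i, hil.trans_le (hk.2 (Finsupp.mem_support_iff.2 hl.ne_bot)), hi⟩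

variable {K : Type*} [Field K] {I : Ideal (MvPolynomial (Fin n) K)}

theorem IsStable.isBoundedStable (hI : IsStable I) : IsBoundedStable ⊤ I :=
  fun u _ hu k hk i hik _ => hI.2 u hu k hk i hik

theorem IsSqfreeStable.isBoundedStable (hI : IsSqfreeStable I) : IsBoundedStable 1 I :=
  fun u hu huI k hk i hik hi => hI.2 u (exponentsLE_one_iff.1 hu) huI k hk i hik <|
    Finsupp.notMem_support_iff.2 (Nat.cast_lt_one.1 hi)

theorem IsBoundedStable.exists_le (hI : IsBoundedStable c I) (hv : ExponentsLE c v)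
    (hu : ExponentsLE c u) (huI : MonMem I u) (hdeg : u.degree ≤ v.degree)
    (hle : ∀ i, (∃ k ∈ v.support, i < k) → u i ≤ v i) :
    ∃ w ≤ v, MonMem I w ∧ (w = u ∨ generatorKey w < generatorKey u) := by
  induction h : generatorKey u using WellFoundedLT.induction generalizing u with
  | ind _ ih =>
    subst h
    by_cases huv : u ≤ v
    · exact ⟨u, huv, huI, .inl rfl⟩
    obtain ⟨k, hk, i, hik, hi⟩ := exists_exchange_le_sup hdeg hle huv
    have hic : (u i : ℕ∞) < c i := lt_of_lt_of_le (mod_cast hi) (hv i)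
    have hkey := generatorKey_exchange_lt hk.1 hik
    obtain ⟨w, hwv, hwI, hw⟩ := ih _ hkey (hu.exchange hik.ne hic) (hI u hu huI k hk i hik hic)
      (by rwa [degree_exchange hk.1]) (fun j hj => by
        obtain rfl | hji := eq_or_ne j i
        · rwa [exchange_apply_right hik.ne]
        · exact (exchange_apply_le hji).trans (hle j hj)) rfl
    exact ⟨w, hwv, hwI, .inr (hw.elim (fun h => h ▸ hkey) fun h => h.trans hkey)⟩

theorem IsBoundedStable.exists_mem_exchangeVars (hI : IsBoundedStable c I)
    (hu : u ∈ minGens I) (hv : v ∈ minGens I) (huc : ExponentsLE c u) (hvc : ExponentsLE c v)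
    (hne : u ≠ v) (hkey : generatorKey u ≤ generatorKey v) :
    ∃ i ∈ exchangeVars c v, v i < u i := by
  by_contra! h
  have hle (i) (hi : ∃ k ∈ v.support, i < k) : u i ≤ v i := by
    by_cases hic : (v i : ℕ∞) < c i
    · exact h i (mem_exchangeVars.2 ⟨hic, hi⟩)
    · exact_mod_cast (huc i).trans (not_lt.1 hic)
  obtain ⟨w, hwv, hwI, hw⟩ :=
    hI.exists_le hvc huc hu.prop (degree_le_of_generatorKey_le hkey) hle
  obtain rfl := hv.eq_of_le hwI hwv
  exact hw.elim hne.symm hkey.not_gt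

theorem IsBoundedStable.exists_generator_le (hI : IsBoundedStable c I) (hvI : MonMem I v)
    (hvc : ExponentsLE c v) (hi : i ∈ exchangeVars c v) :
    ∃ w ∈ minGens I, generatorKey w < generatorKey v ∧ w ≤ v + Finsupp.single i 1 := by
  obtain ⟨hic, l, hl, hil⟩ := mem_exchangeVars.1 hi
  obtain ⟨k, hk⟩ := exists_isMaxVar ⟨l, hl⟩
  have hik : i < k := hil.trans_le (hk.2 hl)
  obtain ⟨w, hw, hwle⟩ := (hI v hvc hvI k hk i hik hic).exists_minGens_le
  refine ⟨w, hw, (generatorKey_mono hwle).trans_lt (generatorKey_exchange_lt hk.1 hik),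
    hwle.trans ?_⟩
  rw [← exchange_add_single hk.1]
  exact le_self_add

theorem IsBoundedStable.exists_resolution (hI : IsBoundedStable c I) (hmon : IsMonomialIdeal I)
    (hc : ∀ u ∈ minGens I, ExponentsLE c u) :
    ∃ F : MinGradedFreeResolution I, ∀ (i : ℕ) (j : ℤ), F.betti i j =
      ∑ u ∈ (minGens_finite I).toFinset,
        if j = i + u.degree then (exchangeVars c u).card.choose i else 0 := by
  have hquot : HasLinearQuotients (exchangeVars c) (minGens_finite I).toFinset := by
    refine hasLinearQuotients_of_key generatorKey ?_ ?_ ?_ <;>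
      simp only [Set.Finite.mem_toFinset]
    · exact fun u _ v _ => degree_le_of_generatorKey_le
    · exact fun u hu v hv => hI.exists_mem_exchangeVars hu hv (hc u hu) (hc v hv)
    · exact fun v hv i hi => hI.exists_generator_le hv.prop (hc v hv) hi
  have h := hquot.exists_resolution K
  rwa [Set.Finite.coe_toFinset, ← hmon.eq_monomialSpan_minGens] at h

end BoundedStable

/-! ### Lowering the variables of monomials in Borel-fixed ideals -/

section LoweringClosed

/-- The set `J` of exponent vectors is closed under replacing all variables by smaller ones, equal
variables being replaced by equal ones. -/
def IsLoweringClosed {α : Type*} [Preorder α] (J : Set (α →₀ ℕ)) : Prop :=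
  ∀ u ∈ J, ∀ f : α → α, (∀ a, f a ≤ a) → u.mapDomain f ∈ J

theorem isLoweringClosed_of_update {α : Type*} [LinearOrder α] {J : Set (α →₀ ℕ)}
    (h : ∀ u ∈ J, ∀ a b, b ≤ a → u.mapDomain (Function.update id a b) ∈ J) :
    IsLoweringClosed J := by
  intro u hu f hf
  suffices hs : ∀ s : Finset α, u.mapDomain (s.piecewise f id) ∈ J by
    have hcongr : u.mapDomain f = u.mapDomain (u.support.piecewise f id) :=
      Finsupp.mapDomain_congr fun a ha => (Finset.piecewise_eq_of_mem _ f id ha).symm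
    exact hcongr ▸ hs u.support
  intro s
  induction s using Finset.induction_on_max with
  | empty => rwa [Finset.piecewise_empty, Finsupp.mapDomain_id]
  | insert a s hmax ih =>
    have has : a ∉ s := fun ha => (hmax a ha).false
    -- Blocks are moved in increasing order, so that none is moved onto a block still to be moved.
    have hcomp : (insert a s).piecewise f id =
        Function.update id a (f a) ∘ s.piecewise f id := by
      funext b
      by_cases hb : b ∈ s
      · have hba : f b ≠ a := ((hf b).trans_lt (hmax b hb)).ne
        simp [hb, hba]
      · obtain rfl | hba := eq_or_ne b a <;> simp [*]
    rw [hcomp, Finsupp.mapDomain_comp]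
    exact h _ ih a (f a) (hf a)

end LoweringClosed

section Borel

variable {K : Type*} [Field K] {n : ℕ} {I : Ideal (MvPolynomial (Fin n) K)}

theorem aeval_update_X_zero_monomial (j : Fin n) (u : Fin n →₀ ℕ) :
    aeval (Function.update X j (0 : MvPolynomial (Fin n) K)) (monomial u (1 : K)) =
      if u j = 0 then monomial u 1 else 0 := by
  rw [aeval_monomial, map_one, one_mul]
  split_ifs with huj
  · rw [monomial_eq, C_1, one_mul]
    refine Finsupp.prod_congr fun i hi => ?_
    rw [Function.update_of_ne]
    rintro rfl
    exact Finsupp.mem_support_iff.1 hi huj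
  · refine Finset.prod_eq_zero (Finsupp.mem_support_iff.2 huj) ?_
    simp only [Function.update_self, zero_pow huj]

theorem IsMonomialIdeal.aeval_update_X_zero_mem (hI : IsMonomialIdeal I) (j : Fin n)
    {p : MvPolynomial (Fin n) K} (hp : p ∈ I) :
    aeval (Function.update X j (0 : MvPolynomial (Fin n) K)) p ∈ I := by
  obtain ⟨A, rfl⟩ := hI
  suffices h : monomialSpan K A ≤
      (monomialSpan K A).comap (aeval (Function.update X j (0 : MvPolynomial (Fin n) K))) from h hp
  refine Ideal.span_le.2 ?_
  rintro _ ⟨a, ha, rfl⟩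
  rw [SetLike.mem_coe, Ideal.mem_comap, aeval_update_X_zero_monomial]
  split_ifs
  · exact Ideal.subset_span ⟨a, ha, rfl⟩
  · exact Ideal.zero_mem _

theorem linearSubst_transvection_X (i j l : Fin n) :
    linearSubst (Matrix.transvection i j (1 : K)) (X l) = X l + if j = l then X i else 0 := by
  simp [linearSubst, Matrix.transvection, Matrix.one_apply, Matrix.single_apply, add_mul,
    Finset.sum_add_distrib, apply_ite C, ite_and, ite_mul]

theorem aeval_update_X_zero_comp_linearSubst_transvection {i j : Fin n} (hij : i ≠ j) :
    (aeval (Function.update X j (0 : MvPolynomial (Fin n) K))).comp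
      (linearSubst (Matrix.transvection i j (1 : K))) = rename (Function.update id j i) := by
  ext1 l
  rw [AlgHom.comp_apply, linearSubst_transvection_X, rename_X]
  obtain rfl | hl := eq_or_ne l j
  · simp [hij]
  · simp [hl, hl.symm]

theorem IsBorelFixed.monMem_mapDomain_update (hbf : IsBorelFixed I) (hI : IsMonomialIdeal I)
    {u : Fin n →₀ ℕ} (hu : MonMem I u) {i j : Fin n} (hij : i < j) :
    MonMem I (u.mapDomain (Function.update id j i)) := by
  have hg : (Matrix.transvection i j (1 : K)).BlockTriangular id :=
    Matrix.blockTriangular_transvection hij.le 1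
  have hdet : IsUnit (Matrix.transvection i j (1 : K)).det := by
    rw [Matrix.det_transvection_of_ne i j hij.ne]
    exact isUnit_one
  have h := Ideal.mem_map_of_mem (linearSubst (Matrix.transvection i j (1 : K))) hu
  rw [hbf _ hg hdet] at h
  replace h := hI.aeval_update_X_zero_mem j h
  rwa [← AlgHom.comp_apply, aeval_update_X_zero_comp_linearSubst_transvection hij.ne,
    rename_monomial] at h

theorem IsBorelFixed.isLoweringClosed (hbf : IsBorelFixed I) (hI : IsMonomialIdeal I) :
    IsLoweringClosed {u | MonMem I u} := by
  refine isLoweringClosed_of_update fun u hu j i hij => ?_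
  obtain rfl | hlt := hij.eq_or_lt
  · rwa [Function.update_eq_self_iff.2 (id_eq i).symm, Finsupp.mapDomain_id]
  · exact hbf.monMem_mapDomain_update hI hu hlt

end Borel

/-! ### Stable and squarefree stable families -/

section StableFamily

theorem le_of_le_add_single {α : Type*} {u w : α →₀ ℕ} {j : α} (hle : w ≤ u + Finsupp.single j 1)
    (hj : w j ≤ u j) : w ≤ u := by
  intro l
  obtain rfl | hl := eq_or_ne l j
  · exact hj
  · simpa [hl] using hle l

variable {α : Type*} [LinearOrder α]

/-- The combinatorial part of the definition of a stable ideal, for the set `J` of exponent vectors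
of its monomials; the set of variables may be infinite. -/
structure IsStableFamily (J : Set (α →₀ ℕ)) : Prop where
  isUpperSet : IsUpperSet J
  exchange_mem : ∀ {u : α →₀ ℕ} {i k : α}, (∀ l ∈ u.support, l ≤ k) → i < k →
    u + Finsupp.single k 1 ∈ J → u + Finsupp.single i 1 ∈ J

/-- The combinatorial part of the definition of a squarefree stable ideal, for the set `P` of
supports of its squarefree monomials. -/
structure IsSqfreeStableFamily (P : Set (Finset α)) : Prop where
  isUpperSet : IsUpperSet P
  exchange_mem : ∀ {W : Finset α} {i k : α}, (∀ l ∈ W, l < k) → i < k → i ∉ W →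
    insert k W ∈ P → insert i W ∈ P

theorem IsStableFamily.minimal_add_single_iff {J : Set (α →₀ ℕ)} (hJ : IsStableFamily J)
    {u : α →₀ ℕ} {k : α} (hk : ∀ l ∈ u.support, l ≤ k) :
    Minimal (· ∈ J) (u + Finsupp.single k 1) ↔ u + Finsupp.single k 1 ∈ J ∧ u ∉ J := by
  refine ⟨fun h => ⟨h.prop, fun hu => ?_⟩, fun ⟨hmem, hu⟩ => ⟨hmem, fun w hw hwu => ?_⟩⟩
  · simpa using DFunLike.congr_fun (h.eq_of_le hu le_self_add) k
  by_contra hlt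
  obtain ⟨j, hj⟩ : ∃ j, w j < (u + Finsupp.single k 1 : α →₀ ℕ) j := by
    by_contra! h
    exact hlt h
  obtain rfl | hjk := eq_or_ne j k
  · refine hu (hJ.isUpperSet (le_of_le_add_single hwu ?_) hw)
    simpa [Nat.lt_succ_iff] using hj
  · have hju : w j < u j := by simpa [hjk] using hj
    have hsup : j ∈ u.support := Finsupp.mem_support_iff.2 hju.ne_bot
    obtain ⟨v, rfl⟩ := exists_add_of_le
      (Finsupp.single_le_iff.2 (Nat.one_le_iff_ne_zero.2 hju.ne_bot))
    rw [add_comm (Finsupp.single j 1) v] at *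
    have hwv : w ≤ v + Finsupp.single k 1 := by
      rw [add_right_comm] at hwu
      refine le_of_le_add_single hwu ?_
      simpa [hjk, Nat.lt_succ_iff] using hju
    have hv (l) (hl : l ∈ v.support) : l ≤ k := hk l (Finsupp.support_mono le_self_add hl)
    exact hu (hJ.exchange_mem hv ((hk j hsup).lt_of_ne hjk) (hJ.isUpperSet hwv hw))

theorem IsSqfreeStableFamily.minimal_insert_iff {P : Set (Finset α)} (hP : IsSqfreeStableFamily P)
    {W : Finset α} {k : α} (hk : ∀ l ∈ W, l < k) :
    Minimal (· ∈ P) (insert k W) ↔ insert k W ∈ P ∧ W ∉ P := by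
  have hkW : k ∉ W := fun h => (hk k h).false
  refine ⟨fun h => ⟨h.prop, fun hW => ?_⟩, fun ⟨hmem, hW⟩ => ⟨hmem, fun w hw hwW j hj => ?_⟩⟩
  · exact hkW (h.le_of_le hW (Finset.subset_insert k W) (Finset.mem_insert_self k W))
  by_contra hjw
  have hwj : w ⊆ (insert k W).erase j := Finset.subset_erase.2 ⟨hwW, hjw⟩
  obtain rfl | hjW := Finset.mem_insert.1 hj
  · exact hW (hP.isUpperSet (hwj.trans (Finset.erase_insert_subset j W)) hw)
  · rw [Finset.erase_insert_of_ne (ne_of_mem_of_not_mem hjW hkW).symm] at hwj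
    have h := hP.exchange_mem (fun l hl => hk l (Finset.mem_of_mem_erase hl)) (hk j hjW)
      (Finset.notMem_erase j W) (hP.isUpperSet hwj hw)
    exact hW (by rwa [Finset.insert_erase hjW] at h)

theorem IsLoweringClosed.sum_single_mem {α ι : Type*} [Preorder α] {J : Set (α →₀ ℕ)}
    (hJ : IsLoweringClosed J) {s : Finset ι} {a b : ι → α}
    (ha : ∑ k ∈ s, Finsupp.single (a k) 1 ∈ J) (hle : ∀ k ∈ s, b k ≤ a k)
    (heq : ∀ k ∈ s, ∀ l ∈ s, a k = a l → b k = b l) :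
    ∑ k ∈ s, Finsupp.single (b k) 1 ∈ J := by
  obtain ⟨f, hf, hfa⟩ : ∃ f : α → α, (∀ x, f x ≤ x) ∧ ∀ k ∈ s, f (a k) = b k := by
    classical
    refine ⟨fun x => if h : ∃ k ∈ s, a k = x then b h.choose else x, fun x => ?_, fun k hk => ?_⟩
    · dsimp only
      split_ifs with h
      · exact (hle _ h.choose_spec.1).trans_eq h.choose_spec.2
      · exact le_rfl
    · have h : ∃ l ∈ s, a l = a k := ⟨k, hk, rfl⟩
      dsimp only
      rw [dif_pos h]
      exact heq _ h.choose_spec.1 k hk h.choose_spec.2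
  have h := hJ _ ha f hf
  simp only [Finsupp.mapDomain_finsetSum, Finsupp.mapDomain_single] at h
  rwa [Finset.sum_congr rfl fun k hk => by rw [hfa k hk]] at h

end StableFamily

/-! ### The inverse of the shift -/

section Unshift

/-- The number of `l < k` that do not belong to `W`. -/
def gapsBelow (W : Finset ℕ) (k : ℕ) : ℕ := (Finset.range k \ W).card

/-- The exponent vector of the monomial whose shift is the squarefree monomial with support `W`:
the `j`-th smallest element `k` of `W`, counted from `0`, stands for the variable with index
`k - j`, which is the number of gaps of `W` below `k`. -/
def unshift (W : Finset ℕ) : ℕ →₀ ℕ := ∑ k ∈ W, Finsupp.single (gapsBelow W k) 1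

variable {V W : Finset ℕ} {k l M : ℕ}

theorem gapsBelow_mono (W : Finset ℕ) : Monotone (gapsBelow W) := fun _ _ h =>
  Finset.card_le_card (Finset.sdiff_subset_sdiff (Finset.range_mono h) le_rfl)

theorem gapsBelow_lt (hkl : k < l) (hk : k ∉ W) : gapsBelow W k < gapsBelow W l := by
  refine Finset.card_lt_card ((Finset.ssubset_iff_of_subset
    (Finset.sdiff_subset_sdiff (Finset.range_mono hkl.le) le_rfl)).2 ⟨k, ?_, ?_⟩)
  · simp [hkl, hk]
  · simp

theorem gapsBelow_anti (h : ∀ m < k, m ∈ W → m ∈ V) : gapsBelow V k ≤ gapsBelow W k := by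
  refine Finset.card_le_card fun m hm => ?_
  rw [Finset.mem_sdiff, Finset.mem_range] at hm ⊢
  exact ⟨hm.1, fun hmW => hm.2 (h m hm.1 hmW)⟩

theorem gapsBelow_congr (h : ∀ m < k, m ∈ W ↔ m ∈ V) : gapsBelow W k = gapsBelow V k :=
  (gapsBelow_anti fun m hm => (h m hm).2).antisymm (gapsBelow_anti fun m hm => (h m hm).1)

theorem gapsBelow_eq_of_gapsBelow_eq (hkl : k ≤ l) (h : ∀ m < l, m ∈ W → m ∈ V)
    (hW : gapsBelow W k = gapsBelow W l) : gapsBelow V k = gapsBelow V l := by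
  refine (gapsBelow_mono V hkl).antisymm (Finset.card_le_card fun m hm => ?_)
  rw [Finset.mem_sdiff, Finset.mem_range] at hm ⊢
  refine ⟨?_, hm.2⟩
  by_contra! hkm
  exact hW.not_lt <| (gapsBelow_mono W hkm).trans_lt <|
    gapsBelow_lt hm.1 fun hmW => hm.2 (h m hm.1 hmW)

theorem gapsBelow_add_card (h : ∀ k ∈ W, k < M) : gapsBelow W M + W.card = M := by
  have h := Finset.card_sdiff_add_card_eq_card fun k hk => Finset.mem_range.2 (h k hk)
  rwa [Finset.card_range] at h

theorem gapsBelow_insert_of_le (h : k ≤ M) : gapsBelow (insert M W) k = gapsBelow W k :=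
  gapsBelow_congr fun _ hm => Finset.mem_insert.trans (or_iff_right (hm.trans_le h).ne)

theorem unshift_empty : unshift ∅ = 0 := Finset.sum_empty

theorem unshift_insert (h : ∀ k ∈ W, k < M) :
    unshift (insert M W) = unshift W + Finsupp.single (gapsBelow W M) 1 := by
  rw [unshift, Finset.sum_insert fun hM => (h M hM).false, add_comm,
    gapsBelow_insert_of_le le_rfl, unshift]
  congr 1
  exact Finset.sum_congr rfl fun k hk => by rw [gapsBelow_insert_of_le (h k hk).le]

theorem degree_unshift (W : Finset ℕ) : (unshift W).degree = W.card := by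
  simp [unshift, map_sum]

theorem mem_support_unshift : k ∈ (unshift W).support ↔ ∃ m ∈ W, gapsBelow W m = k := by
  rw [Finsupp.mem_support_iff, unshift, Finsupp.finsetSum_apply, Ne, Finset.sum_eq_zero_iff]
  simp [Finsupp.single_apply]

theorem le_gapsBelow_of_mem_support_unshift (hM : ∀ l ∈ W, l ≤ M) :
    ∀ k ∈ (unshift W).support, k ≤ gapsBelow W M := by
  intro k hk
  obtain ⟨m, hm, rfl⟩ := mem_support_unshift.1 hk
  exact gapsBelow_mono W (hM m hm)

theorem isGreatest_support_unshift (hM : IsGreatest (W : Set ℕ) M) :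
    IsGreatest ((unshift W).support : Set ℕ) (gapsBelow W M) :=
  ⟨mem_support_unshift.2 ⟨M, hM.1, rfl⟩, le_gapsBelow_of_mem_support_unshift hM.2⟩

theorem isGreatest_insert (h : ∀ k ∈ W, k < M) : IsGreatest (↑(insert M W) : Set ℕ) M := by
  refine ⟨Finset.mem_insert_self M W, fun k hk => ?_⟩
  obtain rfl | hk := Finset.mem_insert.1 hk
  · exact le_rfl
  · exact (h k hk).le

theorem unshift_injective : Function.Injective unshift := by
  intro W
  induction W using Finset.induction_on_max with
  | empty =>
    intro V h
    have hcard := congrArg Finsupp.degree h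
    rw [degree_unshift, degree_unshift, Finset.card_empty] at hcard
    exact (Finset.card_eq_zero.1 hcard.symm).symm
  | insert M W hM ih =>
    intro V h
    have hcard := congrArg Finsupp.degree h
    rw [degree_unshift, degree_unshift, Finset.card_insert_of_notMem fun h => (hM M h).false]
      at hcard
    induction V using Finset.induction_on_max with
    | empty => simp at hcard
    | insert M' V hM' _ =>
      rw [Finset.card_insert_of_notMem fun h => (hM' M' h).false] at hcard
      have hgaps : gapsBelow W M = gapsBelow V M' := by
        have hW := isGreatest_support_unshift (isGreatest_insert hM)
        rw [h, gapsBelow_insert_of_le le_rfl] at hW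
        rw [hW.unique (isGreatest_support_unshift (isGreatest_insert hM')),
          gapsBelow_insert_of_le le_rfl]
      obtain rfl : M = M' := by
        rw [← gapsBelow_add_card hM, ← gapsBelow_add_card hM']
        omega
      rw [unshift_insert hM, unshift_insert hM', hgaps] at h
      rw [ih (add_right_cancel h)]

variable {J : Set (ℕ →₀ ℕ)}

theorem IsLoweringClosed.unshift_mem (hJ : IsLoweringClosed J)
    (hV : ∑ k ∈ V, Finsupp.single (gapsBelow W k) 1 ∈ J)
    (hWV : ∀ l ∈ V, ∀ m < l, m ∈ W → m ∈ V) : unshift V ∈ J := by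
  refine hJ.sum_single_mem hV (fun k hk => gapsBelow_anti (hWV k hk)) fun k hk l hl h => ?_
  obtain hkl | hlk := le_total k l
  · exact gapsBelow_eq_of_gapsBelow_eq hkl (hWV l hl) h
  · exact (gapsBelow_eq_of_gapsBelow_eq hlk (hWV k hk) h.symm).symm

theorem IsStableFamily.isSqfreeStableFamily_unshift (hJ : IsStableFamily J)
    (hlow : IsLoweringClosed J) : IsSqfreeStableFamily {W | unshift W ∈ J} where
  isUpperSet W V hWV hW :=
    hlow.unshift_mem (hJ.isUpperSet (Finset.sum_le_sum_of_subset hWV) hW)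
      fun _ _ _ _ hm => hWV hm
  exchange_mem {W y M} hM hyM hy hW := by
    have hexch : unshift W + Finsupp.single (gapsBelow W y) 1 ∈ J :=
      hJ.exchange_mem (le_gapsBelow_of_mem_support_unshift fun l hl => (hM l hl).le)
        (gapsBelow_lt hyM hy) (by rwa [← unshift_insert hM])
    refine hlow.unshift_mem (W := W) ?_ fun _ _ _ _ hm => Finset.mem_insert_of_mem hm
    rwa [Finset.sum_insert hy, add_comm]

theorem IsStableFamily.minimal_unshift_iff (hJ : IsStableFamily J) (hlow : IsLoweringClosed J) :
    Minimal (fun V => unshift V ∈ J) W ↔ Minimal (· ∈ J) (unshift W) := by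
  induction W using Finset.induction_on_max with
  | empty =>
    have hmin {V : Finset ℕ} : V ≤ ∅ → ∅ ≤ V := fun _ => Finset.empty_subset V
    rw [unshift_empty]
    exact ⟨fun h => ⟨unshift_empty ▸ h.prop, fun _ _ _ => zero_le⟩,
      fun h => ⟨show unshift ∅ ∈ J from unshift_empty ▸ h.prop, fun _ _ => hmin⟩⟩
  | insert M W hM _ =>
    have hP := (hJ.isSqfreeStableFamily_unshift hlow).minimal_insert_iff hM
    rw [unshift_insert hM,
      hJ.minimal_add_single_iff (le_gapsBelow_of_mem_support_unshift fun l hl => (hM l hl).le),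
      ← unshift_insert hM]
    exact hP

end Unshift

/-! ### Monomials in infinitely many variables -/

section Extend

variable {n : ℕ} {u v : Fin n →₀ ℕ}

/-- The monomial `u`, regarded as a monomial in infinitely many variables. -/
def extend (u : Fin n →₀ ℕ) : ℕ →₀ ℕ := u.mapDomain Fin.val

theorem extend_injective : Function.Injective (extend (n := n)) :=
  Finsupp.mapDomain_injective Fin.val_injective

theorem extend_add (u v : Fin n →₀ ℕ) : extend (u + v) = extend u + extend v :=
  Finsupp.mapDomain_add

theorem extend_single (k : Fin n) : extend (Finsupp.single k 1) = Finsupp.single (k : ℕ) 1 :=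
  Finsupp.mapDomain_single

theorem support_extend (u : Fin n →₀ ℕ) : (extend u).support = u.support.map Fin.valEmbedding := by
  rw [extend, Finsupp.mapDomain_support_of_injective Fin.val_injective, Finset.map_eq_image]
  rfl

theorem IsMaxVar.isGreatest_support_extend {k : Fin n} (hk : IsMaxVar u k) :
    IsGreatest ((extend u).support : Set ℕ) k := by
  rw [support_extend]
  refine ⟨Finset.mem_map_of_mem Fin.valEmbedding hk.1, fun l hl => ?_⟩
  obtain ⟨m, hm, rfl⟩ := Finset.mem_map.1 hl
  exact hk.2 hm

theorem extend_le_extend_iff : extend u ≤ extend v ↔ u ≤ v :=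
  Finsupp.mapDomain_le_mapDomain_iff_le Fin.val_injective u v

theorem exists_mapDomain_extend_eq (u : Fin n →₀ ℕ) {f : ℕ → ℕ} (hf : ∀ k, f k ≤ k) :
    ∃ g : Fin n → Fin n, (∀ k, g k ≤ k) ∧ (extend u).mapDomain f = extend (u.mapDomain g) := by
  refine ⟨fun k => ⟨f k, (hf k).trans_lt k.2⟩, fun k => hf k, ?_⟩
  rw [extend, extend, ← Finsupp.mapDomain_comp, ← Finsupp.mapDomain_comp]
  rfl

variable {K : Type*} [Field K] {I : Ideal (MvPolynomial (Fin n) K)}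

/-- The monomials of the ideal generated by `I` in the polynomial ring with one variable for each
natural number. -/
def extendedMonomials (I : Ideal (MvPolynomial (Fin n) K)) : Set (ℕ →₀ ℕ) :=
  {w | ∃ u, MonMem I u ∧ extend u ≤ w}

theorem minimal_mem_extendedMonomials_iff {w : ℕ →₀ ℕ} :
    Minimal (· ∈ extendedMonomials I) w ↔ ∃ u ∈ minGens I, extend u = w := by
  constructor
  · rintro h
    obtain ⟨u, hu, huw⟩ := h.prop
    obtain rfl := h.eq_of_le ⟨u, hu, le_rfl⟩ huw
    refine ⟨u, ⟨hu, fun v hv hvu => ?_⟩, rfl⟩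
    exact extend_le_extend_iff.1 (h.le_of_le ⟨v, hv, le_rfl⟩ (extend_le_extend_iff.2 hvu))
  · rintro ⟨u, hu, rfl⟩
    refine ⟨⟨u, hu.prop, le_rfl⟩, fun w ⟨v, hv, hvw⟩ hwu => ?_⟩
    have huv := hu.le_of_le hv (extend_le_extend_iff.1 (hvw.trans hwu))
    exact (extend_le_extend_iff.2 huv).trans hvw

theorem IsStable.isStableFamily_extendedMonomials (hI : IsStable I) :
    IsStableFamily (extendedMonomials I) where
  isUpperSet _ _ hle := fun ⟨v, hv, hvw⟩ => ⟨v, hv, hvw.trans hle⟩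
  exchange_mem := by
    rintro w i k hk hik ⟨v, hv, hvw⟩
    by_cases hvk : extend v k ≤ w k
    · exact ⟨v, hv, (le_of_le_add_single hvw hvk).trans le_self_add⟩
    have hsupp (l) (hl : l ∈ (extend v).support) : l ≤ k := by
      obtain hl | hl := Finset.mem_union.1 (Finsupp.support_add (Finsupp.support_mono hvw hl))
      · exact hk l hl
      · exact (Finset.mem_singleton.1 (Finsupp.support_single_subset hl)).le
    have hkv : k ∈ (extend v).support := Finsupp.mem_support_iff.2 (not_le.1 hvk).ne_bot
    rw [support_extend] at hkv hsupp
    rw [Finset.mem_map] at hkv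
    obtain ⟨k, hkv, rfl⟩ := hkv
    have hmax : IsMaxVar v k := ⟨hkv, fun l hl => hsupp l (Finset.mem_map_of_mem _ hl)⟩
    let i' : Fin n := ⟨i, hik.trans k.2⟩
    refine ⟨exchange v k i', hI.2 v hv k hmax i' hik, ?_⟩
    have h := congrArg extend (exchange_add_single hkv i')
    simp only [extend_add, extend_single] at h
    rw [← add_le_add_iff_right (Finsupp.single (k : ℕ) 1), h, add_right_comm]
    exact add_le_add_left hvw _

theorem IsLoweringClosed.extendedMonomials (hI : IsLoweringClosed {u | MonMem I u}) :
    IsLoweringClosed (extendedMonomials I) := by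
  rintro w ⟨u, hu, huw⟩ f hf
  obtain ⟨g, hg, hgu⟩ := exists_mapDomain_extend_eq u hf
  exact ⟨u.mapDomain g, hI u hu g hg, hgu ▸ Finsupp.mapDomain_mono huw⟩

end Extend

/-! ### The shift of a monomial -/

section Shift

variable {L : List ℕ} {b s : ℕ}

/-- The list `i_1, i_2 + 1, …, i_d + (d - 1)`, for the list `i_1, i_2, …, i_d`. -/
def shiftList (L : List ℕ) : List ℕ := L.mapIdx fun j i => i + j

theorem length_shiftList (L : List ℕ) : (shiftList L).length = L.length :=
  List.length_mapIdx

theorem shiftList_concat (L : List ℕ) (a : ℕ) :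
    shiftList (L ++ [a]) = shiftList L ++ [a + L.length] :=
  List.mapIdx_concat

theorem lt_of_mem_shiftList (hL : ∀ x ∈ L, x ≤ b) (hs : s ∈ shiftList L) : s < b + L.length := by
  obtain ⟨j, hj, rfl⟩ := List.mem_mapIdx.1 hs
  exact Nat.add_lt_add_of_le_of_lt (hL _ (L.getElem_mem hj)) hj

theorem nodup_shiftList (hL : L.Pairwise (· ≤ ·)) : (shiftList L).Nodup := by
  induction L using List.reverseRecOn with
  | nil => exact List.nodup_nil
  | append_singleton L a ih =>
    rw [List.pairwise_append] at hL
    rw [shiftList_concat, ← List.concat_eq_append, List.nodup_concat]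
    exact ⟨fun h => (lt_of_mem_shiftList (fun x hx => hL.2.2 x hx a (by simp)) h).false, ih hL.1⟩

theorem unshift_toFinset_shiftList (hL : L.Pairwise (· ≤ ·)) :
    unshift (shiftList L).toFinset = Multiset.toFinsupp (L : Multiset ℕ) := by
  induction L using List.reverseRecOn with
  | nil => simp [shiftList, unshift_empty]
  | append_singleton L a ih =>
    rw [List.pairwise_append] at hL
    have hlt (s) (hs : s ∈ (shiftList L).toFinset) : s < a + L.length :=
      lt_of_mem_shiftList (fun x hx => hL.2.2 x hx a (by simp)) (List.mem_toFinset.1 hs)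
    have hgaps : gapsBelow (shiftList L).toFinset (a + L.length) = a := by
      have h := gapsBelow_add_card hlt
      rwa [List.toFinset_card_of_nodup (nodup_shiftList hL.1), length_shiftList,
        Nat.add_right_cancel_iff] at h
    have hinsert : (shiftList (L ++ [a])).toFinset =
        insert (a + L.length) (shiftList L).toFinset := by
      rw [shiftList_concat, List.toFinset_append, List.toFinset_cons, List.toFinset_nil,
        insert_empty_eq, Finset.union_singleton]
    rw [hinsert, unshift_insert hlt, hgaps, ih hL.1, ← Multiset.coe_add, Multiset.toFinsupp_add,
      Multiset.coe_singleton, Multiset.toFinsupp_singleton]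

variable {n N : ℕ} {u : Fin n →₀ ℕ} {w : Fin N →₀ ℕ}

theorem sigmaIndices_eq_shiftList (u : Fin n →₀ ℕ) :
    sigmaIndices u = shiftList ((Finsupp.toMultiset u).sort.map Fin.val) := by
  simp only [sigmaIndices, shiftList, List.bind_eq_flatMap, List.pure_def,
    ← List.map_eq_flatMap]

theorem pairwise_le_sort_map_val (u : Fin n →₀ ℕ) :
    ((Finsupp.toMultiset u).sort.map Fin.val).Pairwise (· ≤ ·) :=
  (Multiset.pairwise_sort _ _).map _ fun _ _ h => h

theorem nodup_sigmaIndices (u : Fin n →₀ ℕ) : (sigmaIndices u).Nodup :=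
  sigmaIndices_eq_shiftList u ▸ nodup_shiftList (pairwise_le_sort_map_val u)

/-- The set of indices of the variables of `u^σ`. -/
def sigmaSet (u : Fin n →₀ ℕ) : Finset ℕ := (sigmaIndices u).toFinset

theorem unshift_sigmaSet (u : Fin n →₀ ℕ) : unshift (sigmaSet u) = extend u := by
  rw [sigmaSet, sigmaIndices_eq_shiftList,
    unshift_toFinset_shiftList (pairwise_le_sort_map_val u), ← Multiset.map_coe,
    Multiset.sort_eq, Finsupp.toMultiset_map, Finsupp.toMultiset_toFinsupp, extend]

theorem card_sigmaSet (u : Fin n →₀ ℕ) : (sigmaSet u).card = u.degree := by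
  rw [← degree_unshift, unshift_sigmaSet, extend, Finsupp.degree_mapDomain]

theorem sigmaSet_injective : Function.Injective (sigmaSet (n := n)) := fun u v h =>
  extend_injective (by rw [← unshift_sigmaSet, h, unshift_sigmaSet])

theorem lt_of_mem_sigmaSet (hN : maxVar u + u.degree ≤ N + 1) (hs : s ∈ sigmaSet u) : s < N := by
  rw [sigmaSet, List.mem_toFinset, sigmaIndices_eq_shiftList] at hs
  have hle {x : ℕ} (hx : x ∈ (Finsupp.toMultiset u).sort.map Fin.val) : x + 1 ≤ maxVar u := by
    obtain ⟨i, hi, rfl⟩ := List.mem_map.1 hx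
    rw [Multiset.mem_sort, Finsupp.mem_toMultiset] at hi
    exact Finset.le_sup (f := fun i : Fin n => (i : ℕ) + 1) hi
  have hlt := lt_of_mem_shiftList (b := maxVar u - 1) (fun x hx => Nat.le_sub_one_of_lt (hle hx)) hs
  rw [List.length_map, Multiset.length_sort, Finsupp.card_toMultiset] at hlt
  obtain ⟨j, hj, -⟩ := List.mem_mapIdx.1 hs
  have hpos := hle (List.getElem_mem hj)
  have hdeg : u.degree = u.sum fun _ => id := rfl
  omega

theorem sigmaMon_apply (N : ℕ) (u : Fin n →₀ ℕ) (k : Fin N) :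
    sigmaMon N u k = if (k : ℕ) ∈ sigmaSet u then 1 else 0 := by
  simp only [sigmaMon, Finsupp.coe_equivFunOnFinite_symm, (nodup_sigmaIndices u).count, sigmaSet,
    List.mem_toFinset]

theorem sqfreeMon_sigmaMon (N : ℕ) (u : Fin n →₀ ℕ) : SqfreeMon (sigmaMon N u) := by
  intro k
  rw [sigmaMon_apply]
  split_ifs <;> simp

theorem support_extend_sigmaMon (hu : ∀ s ∈ sigmaSet u, s < N) :
    (extend (sigmaMon N u)).support = sigmaSet u := by
  ext s
  simp only [support_extend, Finset.mem_map, Finsupp.mem_support_iff, sigmaMon_apply,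
    Fin.valEmbedding_apply, ne_eq, ite_eq_right_iff, one_ne_zero, imp_false, not_not]
  exact ⟨fun ⟨_, hk, hks⟩ => hks ▸ hk, fun hs => ⟨⟨s, hu s hs⟩, hs, rfl⟩⟩

theorem sigmaMon_le_iff (hu : ∀ s ∈ sigmaSet u, s < N) :
    sigmaMon N u ≤ w ↔ sigmaSet u ⊆ (extend w).support := by
  refine ⟨fun h => ?_, fun h k => ?_⟩
  · rw [← support_extend_sigmaMon hu]
    exact Finsupp.support_mono (extend_le_extend_iff.2 h)
  · rw [sigmaMon_apply]
    split_ifs with hk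
    · have hk' := h hk
      rw [support_extend] at hk'
      exact Nat.one_le_iff_ne_zero.2
        (Finsupp.mem_support_iff.1 ((Finset.mem_map' Fin.valEmbedding).1 hk'))
    · exact Nat.zero_le _

theorem degree_eq_card_support_of_sqfreeMon (hw : SqfreeMon w) : w.degree = w.support.card := by
  rw [Finset.card_eq_sum_ones]
  exact Finset.sum_congr rfl fun k hk =>
    (hw k).antisymm (Nat.one_le_iff_ne_zero.2 (Finsupp.mem_support_iff.1 hk))

theorem degree_sigmaMon (hu : ∀ s ∈ sigmaSet u, s < N) :
    (sigmaMon N u).degree = u.degree := by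
  rw [degree_eq_card_support_of_sqfreeMon (sqfreeMon_sigmaMon N u), ← card_sigmaSet,
    ← support_extend_sigmaMon hu, support_extend, Finset.card_map]

end Shift

/-! ### The shift of a stable ideal -/

section SigmaIdeal

variable {n N : ℕ} {K : Type*} [Field K] {I : Ideal (MvPolynomial (Fin n) K)}
  {u : Fin n →₀ ℕ} {W : Finset ℕ}

theorem minimal_unshift_mem_extendedMonomials_iff (hI : IsStable I)
    (hlow : IsLoweringClosed {u | MonMem I u}) :
    Minimal (fun V => unshift V ∈ extendedMonomials I) W ↔ ∃ u ∈ minGens I, sigmaSet u = W := by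
  rw [hI.isStableFamily_extendedMonomials.minimal_unshift_iff hlow.extendedMonomials,
    minimal_mem_extendedMonomials_iff]
  simp only [← unshift_sigmaSet, unshift_injective.eq_iff]

theorem monMem_sigmaIdeal_iff (hI : IsStable I) (hlow : IsLoweringClosed {u | MonMem I u})
    (hN : ∀ u ∈ minGens I, ∀ s ∈ sigmaSet u, s < N) {w : Fin N →₀ ℕ} :
    MonMem (sigmaIdeal N I) w ↔ unshift (extend w).support ∈ extendedMonomials I := by
  have hfam :=
    hI.isStableFamily_extendedMonomials.isSqfreeStableFamily_unshift hlow.extendedMonomials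
  rw [sigmaIdeal, monMem_monomialSpan, Set.exists_mem_image]
  constructor
  · rintro ⟨u, hu, huw⟩
    refine hfam.isUpperSet ((sigmaMon_le_iff (hN u hu)).1 huw) ?_
    exact ((minimal_unshift_mem_extendedMonomials_iff hI hlow).2 ⟨u, hu, rfl⟩).prop
  · intro h
    obtain ⟨W, hW, hmin⟩ := exists_minimal_le_of_wellFoundedLT
      (fun V => unshift V ∈ extendedMonomials I) _ h
    obtain ⟨u, hu, rfl⟩ := (minimal_unshift_mem_extendedMonomials_iff hI hlow).1 hmin
    exact ⟨u, hu, (sigmaMon_le_iff (hN u hu)).2 hW⟩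

theorem isSqfreeStable_sigmaIdeal (hI : IsStable I) (hlow : IsLoweringClosed {u | MonMem I u})
    (hN : ∀ u ∈ minGens I, ∀ s ∈ sigmaSet u, s < N) : IsSqfreeStable (sigmaIdeal N I) := by
  refine ⟨⟨_, ?_, rfl⟩, fun w _ hwI k hk i hik hiw => ?_⟩
  · rintro _ ⟨u, _, rfl⟩
    exact sqfreeMon_sigmaMon N u
  have hfam :=
    hI.isStableFamily_extendedMonomials.isSqfreeStableFamily_unshift hlow.extendedMonomials
  rw [monMem_sigmaIdeal_iff hI hlow hN, support_extend] at hwI ⊢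
  set W := (w.support.erase k).map Fin.valEmbedding with hW
  have hWk : w.support.map Fin.valEmbedding = insert (k : ℕ) W := by
    rw [hW, ← Fin.valEmbedding_apply, ← Finset.map_insert, Finset.insert_erase hk.1]
  have hlt (l) (hl : l ∈ W) : l < k := by
    obtain ⟨m, hm, rfl⟩ := Finset.mem_map.1 hl
    rw [Finset.mem_erase] at hm
    exact (hk.2 hm.2).lt_of_ne hm.1
  have hiW : (i : ℕ) ∉ W := fun h => hiw <|
    Finset.mem_of_mem_erase ((Finset.mem_map' Fin.valEmbedding).1 h)
  refine hfam.isUpperSet ?_ (hfam.exchange_mem hlt hik hiW (hWk ▸ hwI))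
  rw [hW, ← Fin.valEmbedding_apply, ← Finset.map_insert]
  exact Finset.map_subset_map.2 (insert_erase_subset_support_exchange hik.ne)

theorem sigmaMon_injOn (hN : ∀ u ∈ minGens I, ∀ s ∈ sigmaSet u, s < N) :
    Set.InjOn (sigmaMon N) (minGens I) := fun u hu v hv h => sigmaSet_injective <| by
  rw [← support_extend_sigmaMon (hN u hu), h, support_extend_sigmaMon (hN v hv)]

theorem minGens_sigmaIdeal (hI : IsStable I) (hlow : IsLoweringClosed {u | MonMem I u})
    (hN : ∀ u ∈ minGens I, ∀ s ∈ sigmaSet u, s < N) :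
    minGens (sigmaIdeal N I) = sigmaMon N '' minGens I := by
  refine minGens_monomialSpan ?_
  rintro _ ⟨u, hu, rfl⟩ _ ⟨v, hv, rfl⟩ hne h
  rw [sigmaMon_le_iff (hN u hu), support_extend_sigmaMon (hN v hv)] at h
  have hmin {x} (hx : x ∈ minGens I) :=
    (minimal_unshift_mem_extendedMonomials_iff hI hlow).2 ⟨x, hx, rfl⟩
  exact hne (congrArg (sigmaMon N) (sigmaSet_injective ((hmin hv).eq_of_le (hmin hu).prop h)))

theorem card_exchangeVars_one {w : Fin N →₀ ℕ} {k : Fin N} (hk : IsMaxVar w k) :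
    (exchangeVars 1 w).card = gapsBelow (extend w).support k := by
  rw [gapsBelow, support_extend, ← Finset.card_map Fin.valEmbedding]
  congr 1
  ext s
  simp only [Finset.mem_map, mem_exchangeVars, Fin.valEmbedding_apply, Finset.mem_sdiff,
    Finset.mem_range, Pi.one_apply, Nat.cast_lt_one]
  constructor
  · rintro ⟨i, ⟨hi, l, hl, hil⟩, rfl⟩
    refine ⟨hil.trans_le (hk.2 hl), fun ⟨m, hm, hmi⟩ => ?_⟩
    rw [Fin.val_injective hmi] at hm
    exact Finsupp.mem_support_iff.1 hm hi
  · rintro ⟨hs, hsw⟩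
    let i : Fin N := ⟨s, hs.trans k.2⟩
    exact ⟨i, ⟨Finsupp.notMem_support_iff.1 fun hi => hsw ⟨i, hi, rfl⟩, k, hk.1, hs⟩, rfl⟩

theorem card_exchangeVars_sigmaMon (hu : ∀ s ∈ sigmaSet u, s < N) :
    (exchangeVars 1 (sigmaMon N u)).card = (exchangeVars ⊤ u).card := by
  obtain rfl | hu0 := eq_or_ne u 0
  · rw [Finsupp.degree_eq_zero_iff _ |>.1 (degree_sigmaMon hu), exchangeVars_zero,
      exchangeVars_zero, Finset.card_empty, Finset.card_empty]
  have hsupp : (sigmaMon N u).support.Nonempty := by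
    rwa [Finsupp.support_nonempty_iff, ne_eq, ← Finsupp.degree_eq_zero_iff, degree_sigmaMon hu,
      Finsupp.degree_eq_zero_iff]
  obtain ⟨k, hk⟩ := exists_isMaxVar (Finsupp.support_nonempty_iff.2 hu0)
  obtain ⟨M, hM⟩ := exists_isMaxVar hsupp
  have hmax := isGreatest_support_unshift hM.isGreatest_support_extend
  rw [support_extend_sigmaMon hu, unshift_sigmaSet] at hmax
  rw [card_exchangeVars_one hM, card_exchangeVars_top hk, support_extend_sigmaMon hu]
  exact hmax.unique hk.isGreatest_support_extend

end SigmaIdeal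

end

end SqfreeShift

theorem mainTheorem7_general {K : Type*} [Field K] {n : ℕ} (I : Ideal (MvPolynomial (Fin n) K))
    (hst : SqfreeShift.IsStable I)
    (hlow : SqfreeShift.IsLoweringClosed {u | SqfreeShift.MonMem I u})
    (N : ℕ) (hN : ∀ u ∈ SqfreeShift.minGens I, SqfreeShift.maxVar u + u.degree ≤ N + 1) :
    SqfreeShift.IsSqfreeStable (SqfreeShift.sigmaIdeal N I) ∧
    SqfreeShift.minGens (SqfreeShift.sigmaIdeal N I) =
      SqfreeShift.sigmaMon N '' SqfreeShift.minGens I ∧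
    Nonempty (SqfreeShift.MinGradedFreeResolution I) ∧
    Nonempty (SqfreeShift.MinGradedFreeResolution (SqfreeShift.sigmaIdeal N I)) ∧
    ∀ (F : SqfreeShift.MinGradedFreeResolution I)
      (G : SqfreeShift.MinGradedFreeResolution (SqfreeShift.sigmaIdeal N I)) (i : ℕ) (j : ℤ),
      F.betti i j = G.betti i j := by
  have hlt (u) (hu : u ∈ SqfreeShift.minGens I) (s) (hs : s ∈ SqfreeShift.sigmaSet u) : s < N :=
    SqfreeShift.lt_of_mem_sigmaSet (hN u hu) hs
  have hsq := SqfreeShift.isSqfreeStable_sigmaIdeal hst hlow hlt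
  have hgens := SqfreeShift.minGens_sigmaIdeal hst hlow hlt
  have hexp : ∀ w ∈ SqfreeShift.minGens (SqfreeShift.sigmaIdeal N I),
      SqfreeShift.ExponentsLE 1 w := by
    rw [hgens]
    rintro _ ⟨u, _, rfl⟩
    exact SqfreeShift.exponentsLE_one_iff.2 (SqfreeShift.sqfreeMon_sigmaMon N u)
  obtain ⟨F₀, hF₀⟩ := hst.isBoundedStable.exists_resolution hst.1 fun _ _ _ => le_top
  obtain ⟨G₀, hG₀⟩ := hsq.isBoundedStable.exists_resolution ⟨_, rfl⟩ hexp
  refine ⟨hsq, hgens, ⟨F₀⟩, ⟨G₀⟩, fun F G i j => ?_⟩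
  rw [F.betti_eq F₀, G.betti_eq G₀, hF₀, hG₀]
  refine Finset.sum_nbij (SqfreeShift.sigmaMon N) ?_ ?_ ?_ ?_ <;>
    simp only [Set.Finite.coe_toFinset, Set.Finite.mem_toFinset, hgens]
  · exact fun u => Set.mem_image_of_mem _
  · exact SqfreeShift.sigmaMon_injOn hlt
  · exact Set.surjOn_image _ _
  · intro u hu
    rw [SqfreeShift.degree_sigmaMon (hlt u hu), SqfreeShift.card_exchangeVars_sigmaMon (hlt u hu)]

/-- The bound `hN` says that `m(u) + deg u - 1 ≤ N` for all `u ∈ G(I)`, that is, `I^σ` is an ideal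
of `K[x_1, …, x_N]`. Equality of the graded Betti numbers is stated as: both ideals have minimal
graded free resolutions, and any two of them have the same numbers of summands `S(-j)` in each
homological degree `i`. -/
theorem mainTheorem7 {K : Type*} [Field K] [Infinite K] {n : ℕ}
    (I : Ideal (MvPolynomial (Fin n) K))
    (hst : SqfreeShift.IsStable I) (hbf : SqfreeShift.IsBorelFixed I)
    (N : ℕ) (hN : ∀ u ∈ SqfreeShift.minGens I, SqfreeShift.maxVar u + u.degree ≤ N + 1) :
    SqfreeShift.IsSqfreeStable (SqfreeShift.sigmaIdeal N I) ∧
    SqfreeShift.minGens (SqfreeShift.sigmaIdeal N I) =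
      SqfreeShift.sigmaMon N '' SqfreeShift.minGens I ∧
    Nonempty (SqfreeShift.MinGradedFreeResolution I) ∧
    Nonempty (SqfreeShift.MinGradedFreeResolution (SqfreeShift.sigmaIdeal N I)) ∧
    ∀ (F : SqfreeShift.MinGradedFreeResolution I)
      (G : SqfreeShift.MinGradedFreeResolution (SqfreeShift.sigmaIdeal N I)) (i : ℕ) (j : ℤ),
      F.betti i j = G.betti i j :=
  mainTheorem7_general I hst (hbf.isLoweringClosed hst.1) N hN
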